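/- Let $\mathrm{Sol}_3$ be $\mathbb{R}^3$ with the group law $x*y=(y_1e^{-x_3}+x_1,\;y_2e^{x_3}+x_2,\;x_3+y_3)$ and the left-invariant metric $ds^2=e^{2x_3}dx_1^2+e^{-2x_3}dx_2^2+dx_3^2$. For an immersion $x$ of a domain of $\mathbb{C}\ni z=u+iv$, let $N$ be the unit normal such that $(x_u,x_v,N)$ is positively oriented, let $N_1,N_2,N_3$ be its coordinates in the orthonormal frame $e^{-x_3}\partial_1,\ e^{x_3}\partial_2,\ \partial_3$, and let its Gauss map be $\frac{N_1+iN_2}{1+N_3}\in\mathbb{C}\cup\{\infty\}$ (equal to $\infty$ when $N_3=-1$). **Theorem.** Let $\alpha\in(-1,1)\setminus\{0\}$. There are unique functions $\rho,\gamma:\mathbb{R}\to\mathbb{R}$ with $$\rho'=\sqrt{1-\alpha^2\sin^2(2\rho)},\quad \rho(0)=0,\qquad \gamma'=-\alpha\sin(2\rho),\quad \gamma(0)=0.$$ Put $F(v)=\alpha^2\int_0^v\frac{\sin(2\rho(s))}{1+\rho'(s)}\,ds$ and define $x:\mathbb{C}\to\mathrm{Sol}_3$ by $$x(u+iv)=\begin{pmatrix}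 e^{-\alpha u-F}\Big[\frac{e^{u+\gamma}}{2(1-\alpha)}(F'\cos\rho-\alpha\sin\rho)-\frac{e^{-u-\gamma}}{2(1+\alpha)}(\alpha\sin\rho+F'\cos\rho)\Big]\\[4pt] e^{\alpha u+F}\Big[\frac{e^{u+\gamma}}{2(1+\alpha)}(\alpha\cos\rho+F'\sin\rho)+\frac{e^{-u-\gamma}}{2(1-\alpha)}(\alpha\cos\rho-F'\sin\rho)\Big]\\[4pt] \alpha u+F\end{pmatrix},$$ where $\rho,\gamma,F,F'$ are evaluated at $v$. Let $\mathcal{C}_\alpha=x(\mathbb{C})$. Then: 1. $x$ is a smooth conformal minimal immersion whose Gauss map is $g(u+iv)=-ie^{-u-\gamma(v)}e^{i\rho(v)}$. 2. There is $V>0$ with $\rho(v+V)=\rho(v)+\pi$ for all $v\in\mathbb{R}$; the map $x$ is $2iV$-periodic, and $x(z)=x(w)$ if and only if $z-w\in 2iV\mathbb{Z}$. 3. $\mathcal{C}_\alpha$ is a properly embedded minimal annulus. 4. For every $\lambda\in\mathbb{R}$, the intersection $\mathcal{C}_\alpha\cap\{x_3=\lambda\}$ is a non-empty smooth closed embedded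 convex curve of the flat plane $\{x_3=\lambda\}$ (a regular simple closed curve lying on one side of each of its tangent lines). 5. $\mathcal{C}_\alpha$, with the induced metric, is conformally equivalent to $\mathbb{C}\setminus\{0\}$. 6. $\mathcal{C}_\alpha$ is invariant under the rotation $(x_1,x_2,x_3)\mapsto(-x_1,-x_2,x_3)$ of angle $\pi$ around the $x_3$-axis, under the reflection $(x_1,x_2,x_3)\mapsto(-x_1,x_2,x_3)$ with respect to $\{x_1=0\}$, and under the reflection $(x_1,x_2,x_3)\mapsto(x_1,-x_2,x_3)$ with respect to $\{x_2=0\}$; no other non-identity element of the dihedral group of order $8$ generated by $\sigma:(x_1,x_2,x_3)\mapsto(x_2,-x_1,-x_3)$ and $\tau:(x_1,x_2,x_3)\mapsto(-x_1,x_2,x_3)$ (the isotropy group of the origin) leaves $\mathcal{C}_\alpha$ invariant. -/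

import Mathlib

open Set Topology Matrix
open scoped ContDiff

noncomputable section

/-! ### The Lie group Sol₃ and its standard left-invariant metric -/

/-- The underlying manifold `ℝ³` of Sol₃, with coordinates `(x₁, x₂, x₃) = (x 0, x 1, x 2)`. -/
abbrev Sol3 : Type := Fin 3 → ℝ

/-- The group law of Sol₃. -/
def solMul (x y : Sol3) : Sol3 :=
  ![y 0 * Real.exp (-x 2) + x 0, y 1 * Real.exp (x 2) + x 1, x 2 + y 2]

/-- The inverse for the group law of Sol₃. -/
def solInv (x : Sol3) : Sol3 :=
  ![-x 0 * Real.exp (x 2), -x 1 * Real.exp (-x 2), -x 2]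

theorem solMul_assoc (x y z : Sol3) :
    solMul (solMul x y) z = solMul x (solMul y z) := by
  ext i
  fin_cases i <;> simp [solMul, Real.exp_add] <;> ring

theorem solMul_zero (x : Sol3) : solMul x 0 = x := by
  ext i
  fin_cases i <;> simp [solMul]

theorem solMul_solInv (x : Sol3) : solMul x (solInv x) = 0 := by
  ext i
  fin_cases i <;> simp [solMul, solInv, mul_assoc, ← Real.exp_add]

/-- The differential `M_a` of the left translation `x ↦ a * x`. -/
def solM (a : Sol3) (X : Fin 3 → ℝ) : Fin 3 → ℝ :=
  ![Real.exp (-a 2) * X 0, Real.exp (a 2) * X 1, X 2]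

/-- The standard left-invariant metric `(X, Y)_p = ⟨M_{p⁻¹} X, M_{p⁻¹} Y⟩`. -/
def solMetric (p : Sol3) (X Y : Fin 3 → ℝ) : ℝ :=
  solM (solInv p) X ⬝ᵥ solM (solInv p) Y

/-- The metric is `e^{2x₃} dx₁² + e^{-2x₃} dx₂² + dx₃²`. -/
theorem solMetric_eq (p : Sol3) (X Y : Fin 3 → ℝ) :
    solMetric p X Y = Real.exp (2 * p 2) * (X 0 * Y 0)
      + Real.exp (-(2 * p 2)) * (X 1 * Y 1) + X 2 * Y 2 := by
  have h1 : Real.exp (2 * p 2) = Real.exp (p 2) * Real.exp (p 2) := by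
    rw [← Real.exp_add]; ring_nf
  have h2 : Real.exp (-(2 * p 2)) = Real.exp (-p 2) * Real.exp (-p 2) := by
    rw [← Real.exp_add]; ring_nf
  simp [solMetric, solM, solInv, dotProduct, Fin.sum_univ_three, h1, h2]
  ring

/-- The matrix `(g_{ij})` of the metric in the coordinate frame. -/
def metricMatrix (p : Sol3) : Matrix (Fin 3) (Fin 3) ℝ :=
  Matrix.of fun i j => solMetric p (Pi.single i 1) (Pi.single j 1)

/-- The partial derivative `∂_i g_{jl}`. -/
def metricDeriv (p : Sol3) (i j l : Fin 3) : ℝ :=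
  fderiv ℝ (fun q : Sol3 => metricMatrix q j l) p (Pi.single i 1)

/-- The Christoffel symbol `Γ^k_{ij}` of the Levi-Civita connection of the metric. -/
def christoffel (p : Sol3) (k i j : Fin 3) : ℝ :=
  1 / 2 * ∑ l, (metricMatrix p)⁻¹ k l *
    (metricDeriv p i j l + metricDeriv p j i l - metricDeriv p l i j)

/-! ### Parametrized surfaces `x : ℂ → Sol₃`, in the coordinate `z = u + i v` -/

/-- The coordinate directions `∂_u`, `∂_v` of the parameter plane. -/
def dir (a : Fin 2) : ℂ := ![1, Complex.I] a

/-- The partial derivative `x_u` (`a = 0`) or `x_v` (`a = 1`). -/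
def partialD (x : ℂ → Sol3) (a : Fin 2) (z : ℂ) : Fin 3 → ℝ :=
  fderiv ℝ x z (dir a)

/-- The covariant derivative `∇_{x_a} x_b` along the surface. -/
def covD (x : ℂ → Sol3) (a b : Fin 2) (z : ℂ) : Fin 3 → ℝ := fun k =>
  fderiv ℝ (fun w => partialD x b w) z (dir a) k
    + ∑ i, ∑ j, christoffel (x z) k i j * partialD x a z i * partialD x b z j

/-- The first fundamental form (the metric induced by `x`). -/
def firstForm (x : ℂ → Sol3) (z : ℂ) : Matrix (Fin 2) (Fin 2) ℝ :=
  Matrix.of fun a b => solMetric (x z) (partialD x a z) (partialD x b z)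

/-- The unit normal positively oriented with respect to `(x_u, x_v)`, in the orthonormal
left-invariant frame `E₁ = e^{-x₃} ∂₁`, `E₂ = e^{x₃} ∂₂`, `E₃ = ∂₃`, that is,
the vector `M_{x⁻¹} N` of the unit sphere. -/
def frameNormal (x : ℂ → Sol3) (z : ℂ) : Fin 3 → ℝ :=
  let n := solM (solInv (x z)) (partialD x 0 z) ⨯₃ solM (solInv (x z)) (partialD x 1 z)
  (Real.sqrt (n ⬝ᵥ n))⁻¹ • n

/-- The unit normal `N` in the coordinate frame. -/
def unitNormal (x : ℂ → Sol3) (z : ℂ) : Fin 3 → ℝ :=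
  solM (x z) (frameNormal x z)

/-- The second fundamental form with respect to the unit normal `N`. -/
def secondForm (x : ℂ → Sol3) (z : ℂ) : Matrix (Fin 2) (Fin 2) ℝ :=
  Matrix.of fun a b => solMetric (x z) (covD x a b z) (unitNormal x z)

/-- The mean curvature: half the trace of the second fundamental form with respect to the first. -/
def meanCurvature (x : ℂ → Sol3) (z : ℂ) : ℝ :=
  1 / 2 * ((firstForm x z)⁻¹ * secondForm x z).trace

/-- `x` is a smooth immersion on the open set `U`. -/
def IsSmoothImmersionOn (x : ℂ → Sol3) (U : Set ℂ) : Prop :=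
  ContDiffOn ℝ ∞ x U ∧ ∀ z ∈ U, Function.Injective (fderiv ℝ x z)

/-- `x` is conformal on `U`: the induced metric is a multiple of `du² + dv²`. -/
def IsConformalOn (x : ℂ → Sol3) (U : Set ℂ) : Prop :=
  ∀ z ∈ U, firstForm x z 0 0 = firstForm x z 1 1 ∧ firstForm x z 0 1 = 0

/-- `x` has vanishing mean curvature on `U`. -/
def IsMinimalOn (x : ℂ → Sol3) (U : Set ℂ) : Prop :=
  ∀ z ∈ U, meanCurvature x z = 0

open Classical in
/-- Stereographic projection of the unit sphere from the south pole onto `ℂ ∪ {∞}`. -/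
def stereoSouth (N : Fin 3 → ℝ) : OnePoint ℂ :=
  if N 2 = -1 then OnePoint.infty
  else (((N 0 : ℂ) + Complex.I * (N 1 : ℂ)) / (1 + (N 2 : ℂ)) : ℂ)

/-- The Gauss map of `x`. -/
def gaussMap (x : ℂ → Sol3) (z : ℂ) : OnePoint ℂ :=
  stereoSouth (frameNormal x z)

/-! ### Properly embedded minimal annuli, conformal type, convex curves -/

/-- `φ`, restricted to `ℂ ∖ {0}`, is a smooth embedding with image `S`: an injective immersion
that is a homeomorphism onto its image. -/
def IsSmoothEmbeddingOnto (φ : ℂ → Sol3) (S : Set Sol3) : Prop :=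
  IsSmoothImmersionOn φ {0}ᶜ ∧ IsEmbedding (({0}ᶜ : Set ℂ).domRestrict φ) ∧ φ '' {0}ᶜ = S

/-- `S` is a properly embedded minimal annulus: the image of a proper minimal embedding of the
annulus, where the punctured plane `ℂ ∖ {0}` is the model of the smooth annulus `𝕊¹ × ℝ`
(no conformality is asked of the parametrization). -/
def IsProperlyEmbeddedMinimalAnnulus (S : Set Sol3) : Prop :=
  ∃ φ : ℂ → Sol3, IsSmoothEmbeddingOnto φ S ∧ IsProperMap (({0}ᶜ : Set ℂ).domRestrict φ) ∧
    IsMinimalOn φ {0}ᶜ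

/-- The embedded surface `S`, with the metric induced by Sol₃, is conformally equivalent to
`ℂ ∖ {0}`. -/
def IsConformalToPuncturedPlane (S : Set Sol3) : Prop :=
  ∃ φ : ℂ → Sol3, IsSmoothEmbeddingOnto φ S ∧ IsConformalOn φ {0}ᶜ

/-- `Γ` is a smooth closed embedded convex curve of the plane: it is the trace of a smooth regular
periodic curve, injective modulo its period, that lies on one side of each of its tangent lines. -/
def IsClosedEmbeddedConvexCurve (Γ : Set (Fin 2 → ℝ)) : Prop :=
  ∃ (c : ℝ → Fin 2 → ℝ) (T : ℝ), 0 < T ∧ ContDiff ℝ ∞ c ∧ (∀ t, deriv c t ≠ 0) ∧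
    (∀ s t, c s = c t ↔ ∃ k : ℤ, s = t + k * T) ∧ range c = Γ ∧
    ∀ t, (∀ s, 0 ≤ deriv c t 0 * (c s 1 - c t 1) - deriv c t 1 * (c s 0 - c t 0)) ∨
      (∀ s, deriv c t 0 * (c s 1 - c t 1) - deriv c t 1 * (c s 0 - c t 0) ≤ 0)

/-- The intersection of `S` with the plane `{x₃ = l}`, in the coordinates `(x₁, x₂)`. These are
affine coordinates of the flat plane `{x₃ = l}`, whose metric is
`e^{2l} dx₁² + e^{-2l} dx₂²`, so convexity may be read in them. -/
def slice (S : Set Sol3) (l : ℝ) : Set (Fin 2 → ℝ) :=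
  {p | ![p 0, p 1, l] ∈ S}

/-! ### Isometries of Sol₃ fixing the origin -/

/-- The rotation of angle `π` around the `x₃`-axis. -/
def rotationX3 (x : Sol3) : Sol3 := ![-x 0, -x 1, x 2]

/-- The reflection with respect to `{x₁ = 0}`. -/
def reflectionX1 (x : Sol3) : Sol3 := ![-x 0, x 1, x 2]

/-- The reflection with respect to `{x₂ = 0}`. -/
def reflectionX2 (x : Sol3) : Sol3 := ![x 0, -x 1, x 2]

/-- The isometry `σ : (x₁, x₂, x₃) ↦ (x₂, -x₁, -x₃)`. -/
def isoSigma : Equiv.Perm Sol3 where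
  toFun x := ![x 1, -x 0, -x 2]
  invFun x := ![-x 1, x 0, -x 2]
  left_inv x := by ext i; fin_cases i <;> simp
  right_inv x := by ext i; fin_cases i <;> simp

/-- The isometry `τ : (x₁, x₂, x₃) ↦ (-x₁, x₂, x₃)`. -/
def isoTau : Equiv.Perm Sol3 where
  toFun x := ![-x 0, x 1, x 2]
  invFun x := ![-x 0, x 1, x 2]
  left_inv x := by ext i; fin_cases i <;> simp
  right_inv x := by ext i; fin_cases i <;> simp

/-- The group of isometries of Sol₃ fixing the origin: the dihedral group of order 8 generated by
`σ` and `τ`. -/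
def originIsotropy : Subgroup (Equiv.Perm Sol3) :=
  Subgroup.closure {isoSigma, isoTau}

/-! ### The catenoids -/

/-- `ρ' = √(1 - α² sin²(2ρ))` on `ℝ`, `ρ(0) = 0`. -/
def IsRho (α : ℝ) (ρ : ℝ → ℝ) : Prop :=
  ρ 0 = 0 ∧ ∀ v, HasDerivAt ρ (Real.sqrt (1 - α ^ 2 * Real.sin (2 * ρ v) ^ 2)) v

/-- `γ' = -α sin(2ρ)` on `ℝ`, `γ(0) = 0`. -/
def IsGamma (α : ℝ) (ρ γ : ℝ → ℝ) : Prop :=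
  γ 0 = 0 ∧ ∀ v, HasDerivAt γ (-α * Real.sin (2 * ρ v)) v

/-- `F(v) = α² ∫₀^v sin(2ρ(s)) / (1 + ρ'(s)) ds`. -/
def catF (α : ℝ) (ρ : ℝ → ℝ) (v : ℝ) : ℝ :=
  α ^ 2 * ∫ s in (0 : ℝ)..v, Real.sin (2 * ρ s) / (1 + deriv ρ s)

/-- The first coordinate of the catenoid immersion at `u + i v`. -/
def catX1 (α : ℝ) (ρ γ : ℝ → ℝ) (u v : ℝ) : ℝ :=
  Real.exp (-α * u - catF α ρ v) *
    (Real.exp (u + γ v) / (2 * (1 - α)) *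
        (Real.cos (ρ v) * deriv (catF α ρ) v - α * Real.sin (ρ v))
      - Real.exp (-u - γ v) / (2 * (1 + α)) *
        (α * Real.sin (ρ v) + Real.cos (ρ v) * deriv (catF α ρ) v))

/-- The second coordinate of the catenoid immersion at `u + i v`. -/
def catX2 (α : ℝ) (ρ γ : ℝ → ℝ) (u v : ℝ) : ℝ :=
  Real.exp (α * u + catF α ρ v) *
    (Real.exp (u + γ v) / (2 * (1 + α)) *
        (α * Real.cos (ρ v) + deriv (catF α ρ) v * Real.sin (ρ v))
      + Real.exp (-u - γ v) / (2 * (1 - α)) *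
        (α * Real.cos (ρ v) - deriv (catF α ρ) v * Real.sin (ρ v)))

/-- The third coordinate of the catenoid immersion at `u + i v`. -/
def catX3 (α : ℝ) (ρ : ℝ → ℝ) (u v : ℝ) : ℝ :=
  α * u + catF α ρ v

/-- The catenoid immersion `x : ℂ → Sol₃`. -/
def catImmersion (α : ℝ) (ρ γ : ℝ → ℝ) (z : ℂ) : Sol3 :=
  ![catX1 α ρ γ z.re z.im, catX2 α ρ γ z.re z.im, catX3 α ρ z.re z.im]

/-- The catenoid `𝒞_α`. -/
def catenoid (α : ℝ) (ρ γ : ℝ → ℝ) : Set Sol3 :=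
  range (catImmersion α ρ γ)

/-- The map `g(u + i v) = -i e^{-u-γ(v)} e^{iρ(v)}`. -/
def catGauss (ρ γ : ℝ → ℝ) (z : ℂ) : ℂ :=
  -Complex.I * (Real.exp (-z.re - γ z.im) : ℂ) * Complex.exp (Complex.I * (ρ z.im : ℂ))

end

/-! The angle `ρ` solves an autonomous equation, so it is the inverse of the time function
`angleTime`. By uniqueness it is odd, and it gains `π` in the time `V = halfPeriod α`. Hence `γ` and
`F`, primitives of odd `V`-periodic functions, are even and `V`-periodic. This makes `x` periodic of
period `2iV`, and turns `z ↦ z + iV` and `z ↦ conj z` into the rotation and the first reflection.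

Write `G = F'`, `K = G² + α²`, `t = u + γ`. The square root in `ρ'` is removed by the relations `K
(1 + ρ') = 2α²` and `ρ' = 1 - 2 G sin ρ cos ρ`, so that the derivatives of `x` in the left-invariant
frame become polynomials in `sin ρ`, `cos ρ`, `G`, `cosh t`, `sinh t`. Conformality, with factor `K
cosh² t`, the Gauss map, and the vanishing of the tension field (that is, minimality in conformal
coordinates) are then polynomial identities modulo `sin² + cos² = 1` and `cosh² - sinh² = 1`.

The geometric core is `tangent_side_pos`. Along a slice `x₃ = l` one has `u = (l - F)/α`, and the
velocity is `m (e^{-l} cos ρ, e^l sin ρ)` with `m` of constant sign. The tangent direction turns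
monotonically, exactly once per period, and the curve closes up; so it lies strictly on one side of
each tangent line away from the point of contact. This gives convexity and injectivity of the slices
at once, and injectivity of `x` modulo `2iV`, since points with the same image lie on the same
slice.

Through `ζ = e^{πz/V}` the immersion descends to an injective conformal map of `ℂ ∖ {0}`. It is
proper because `x₃` is a nonzero multiple of `log |ζ|` up to a bounded term, hence it is a closed
embedding.

An isotropy outside the three symmetries exchanges the first two coordinates. It would send one of
the points `(0, ±α/(1-α²), 0)` of the slice at height `0` to a point of the `x₁`-axis which that
slice does not reach: by `width_lt` its half-width in the `x₁` direction is strictly less than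
`|α|/(1-α²)`. -/

noncomputable section

/-! ### The angle function -/

/-- The right-hand side of the differential equation of the angle function. -/
def angleSpeed (α r : ℝ) : ℝ :=
  Real.sqrt (1 - α ^ 2 * Real.sin (2 * r) ^ 2)

theorem angleSpeed_radicand_pos {α : ℝ} (hα : α ∈ Ioo (-1 : ℝ) 1) (r : ℝ) :
    0 < 1 - α ^ 2 * Real.sin (2 * r) ^ 2 := by
  have h1 : α ^ 2 < 1 := by nlinarith [hα.1, hα.2]
  nlinarith [Real.sin_sq_le_one (2 * r), sq_nonneg (Real.sin (2 * r)), sq_nonneg α]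

theorem angleSpeed_pos {α : ℝ} (hα : α ∈ Ioo (-1 : ℝ) 1) (r : ℝ) : 0 < angleSpeed α r :=
  Real.sqrt_pos.2 (angleSpeed_radicand_pos hα r)

theorem angleSpeed_le_one (α r : ℝ) : angleSpeed α r ≤ 1 :=
  Real.sqrt_le_one.2 (by nlinarith [sq_nonneg (α * Real.sin (2 * r))])

theorem angleSpeed_sq {α : ℝ} (hα : α ∈ Ioo (-1 : ℝ) 1) (r : ℝ) :
    angleSpeed α r ^ 2 = 1 - α ^ 2 * Real.sin (2 * r) ^ 2 :=
  Real.sq_sqrt (angleSpeed_radicand_pos hα r).le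

theorem angleSpeed_add_pi (α r : ℝ) : angleSpeed α (r + Real.pi) = angleSpeed α r := by
  simp [angleSpeed, mul_add, Real.sin_add_two_pi]

theorem angleSpeed_neg (α r : ℝ) : angleSpeed α (-r) = angleSpeed α r := by
  simp [angleSpeed]

theorem contDiff_angleSpeed {α : ℝ} (hα : α ∈ Ioo (-1 : ℝ) 1) {n : WithTop ℕ∞} :
    ContDiff ℝ n (angleSpeed α) := by
  refine ContDiff.sqrt ?_ fun r => (angleSpeed_radicand_pos hα r).ne'
  exact contDiff_const.sub
    (contDiff_const.mul ((Real.contDiff_sin.comp (contDiff_const.mul contDiff_id)).pow 2))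

/-- The time at which the angle function takes the value `r`. -/
def angleTime (α r : ℝ) : ℝ := ∫ s in (0 : ℝ)..r, (angleSpeed α s)⁻¹

theorem angleTime_zero (α : ℝ) : angleTime α 0 = 0 := by simp [angleTime]

theorem hasDerivAt_angleTime {α : ℝ} (hα : α ∈ Ioo (-1 : ℝ) 1) (r : ℝ) :
    HasDerivAt (angleTime α) (angleSpeed α r)⁻¹ r := by
  have hc : Continuous fun s => (angleSpeed α s)⁻¹ :=
    (contDiff_angleSpeed hα (n := 0)).continuous.inv₀ fun s => (angleSpeed_pos hα s).ne'
  exact intervalIntegral.integral_hasDerivAt_right (hc.intervalIntegrable _ _)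
    hc.aestronglyMeasurable.stronglyMeasurableAtFilter hc.continuousAt

theorem strictMono_angleTime {α : ℝ} (hα : α ∈ Ioo (-1 : ℝ) 1) : StrictMono (angleTime α) :=
  strictMono_of_hasDerivAt_pos (hasDerivAt_angleTime hα)
    fun r => inv_pos.2 (angleSpeed_pos hα r)

/-- The speed is at most `1`, so the time has derivative at least `1`. Comparison with the identity
then makes `angleTime` unbounded in both directions, so solutions exist on the whole line. -/
theorem monotone_angleTime_sub_id {α : ℝ} (hα : α ∈ Ioo (-1 : ℝ) 1) :
    Monotone fun r => angleTime α r - r := by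
  refine monotone_of_hasDerivAt_nonneg
    (fun r => (hasDerivAt_angleTime hα r).sub (hasDerivAt_id r)) fun r => ?_
  have := (one_le_inv₀ (angleSpeed_pos hα r)).2 (angleSpeed_le_one α r)
  simpa using this

theorem surjective_angleTime {α : ℝ} (hα : α ∈ Ioo (-1 : ℝ) 1) :
    Function.Surjective (angleTime α) := by
  have hm := monotone_angleTime_sub_id hα
  refine Continuous.surjective
    (continuous_iff_continuousAt.2 fun r => (hasDerivAt_angleTime hα r).continuousAt) ?_ ?_
  · refine Filter.tendsto_atTop_mono' _ ?_ Filter.tendsto_id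
    filter_upwards [Filter.eventually_ge_atTop 0] with r hr
    have := hm hr
    simp only [angleTime_zero] at this
    simpa using this
  · refine Filter.tendsto_atBot_mono' _ ?_ Filter.tendsto_id
    filter_upwards [Filter.eventually_le_atBot 0] with r hr
    have := hm hr
    simp only [angleTime_zero] at this
    simpa using this

theorem eq_of_hasDerivAt_eq {f g f' : ℝ → ℝ} (hf : ∀ v, HasDerivAt f (f' v) v)
    (hg : ∀ v, HasDerivAt g (f' v) v) (h0 : f 0 = g 0) : f = g := by
  funext v
  have h : ∀ v, HasDerivAt (fun v => f v - g v) 0 v := fun v =>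
    ((hf v).sub (hg v)).congr_deriv (sub_self _)
  have := is_const_of_deriv_eq_zero (fun v => (h v).differentiableAt) (fun v => (h v).deriv) v 0
  simp only [h0, sub_self] at this
  linarith

/-- Separation of variables: along any solution `angleTime α ∘ ρ` has derivative `1`. Uniqueness and
the values of `ρ` at distinguished times both come from this. -/
theorem IsRho.angleTime_apply {α : ℝ} (hα : α ∈ Ioo (-1 : ℝ) 1) {ρ : ℝ → ℝ} (hρ : IsRho α ρ)
    (v : ℝ) : angleTime α (ρ v) = v := by
  have h : ∀ v, HasDerivAt (fun v => angleTime α (ρ v)) 1 v := fun v => by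
    have h2 := (hasDerivAt_angleTime hα (ρ v)).comp v (hρ.2 v)
    rwa [show (angleSpeed α (ρ v))⁻¹ * Real.sqrt (1 - α ^ 2 * Real.sin (2 * ρ v) ^ 2) = 1 from
      inv_mul_cancel₀ (angleSpeed_pos hα (ρ v)).ne'] at h2
  exact congrFun (eq_of_hasDerivAt_eq h hasDerivAt_id
    (by simp [hρ.1, angleTime_zero])) v

theorem IsRho.apply_angleTime {α : ℝ} (hα : α ∈ Ioo (-1 : ℝ) 1) {ρ : ℝ → ℝ} (hρ : IsRho α ρ)
    (r : ℝ) : ρ (angleTime α r) = r :=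
  (strictMono_angleTime hα).injective (hρ.angleTime_apply hα _)

theorem IsRho.unique {α : ℝ} (hα : α ∈ Ioo (-1 : ℝ) 1) {ρ ρ' : ℝ → ℝ} (hρ : IsRho α ρ)
    (hρ' : IsRho α ρ') : ρ' = ρ := by
  funext v
  exact (strictMono_angleTime hα).injective
    ((hρ'.angleTime_apply hα v).trans (hρ.angleTime_apply hα v).symm)

theorem exists_isRho {α : ℝ} (hα : α ∈ Ioo (-1 : ℝ) 1) : ∃ ρ, IsRho α ρ := by
  let e := (strictMono_angleTime hα).orderIsoOfSurjective _ (surjective_angleTime hα)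
  have he : ∀ v, angleTime α (e.symm v) = v := e.apply_symm_apply
  refine ⟨e.symm, (strictMono_angleTime hα).injective (by rw [he, angleTime_zero]), fun v => ?_⟩
  have := (hasDerivAt_angleTime hα (e.symm v)).of_local_left_inverse
    e.symm.continuous.continuousAt (inv_pos.2 (angleSpeed_pos hα _)).ne'
    (Filter.Eventually.of_forall he)
  rwa [inv_inv] at this

theorem IsRho.hasDerivAt {α : ℝ} {ρ : ℝ → ℝ} (hρ : IsRho α ρ) (v : ℝ) :
    HasDerivAt ρ (angleSpeed α (ρ v)) v := hρ.2 v

theorem IsRho.deriv_eq {α : ℝ} {ρ : ℝ → ℝ} (hρ : IsRho α ρ) (v : ℝ) :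
    deriv ρ v = angleSpeed α (ρ v) := (hρ.2 v).deriv

theorem IsRho.strictMono {α : ℝ} (hα : α ∈ Ioo (-1 : ℝ) 1) {ρ : ℝ → ℝ} (hρ : IsRho α ρ) :
    StrictMono ρ :=
  strictMono_of_hasDerivAt_pos hρ.hasDerivAt fun _ => angleSpeed_pos hα _

theorem IsRho.neg {α : ℝ} (hα : α ∈ Ioo (-1 : ℝ) 1) {ρ : ℝ → ℝ} (hρ : IsRho α ρ) (v : ℝ) :
    ρ (-v) = -ρ v := by
  have h : IsRho α fun v => -ρ (-v) := by
    refine ⟨by simp [hρ.1], fun v => ?_⟩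
    exact ((hρ.2 (-v)).comp v (hasDerivAt_neg v)).neg.congr_deriv (by simp)
  have : -ρ (-v) = ρ v := congrFun (hρ.unique hα h) v
  linarith

/-- The half-period of the catenoid immersion. -/
def halfPeriod (α : ℝ) : ℝ := angleTime α Real.pi

theorem halfPeriod_pos {α : ℝ} (hα : α ∈ Ioo (-1 : ℝ) 1) : 0 < halfPeriod α := by
  rw [← angleTime_zero α]
  exact strictMono_angleTime hα Real.pi_pos

theorem IsRho.apply_halfPeriod {α : ℝ} (hα : α ∈ Ioo (-1 : ℝ) 1) {ρ : ℝ → ℝ} (hρ : IsRho α ρ) :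
    ρ (halfPeriod α) = Real.pi := hρ.apply_angleTime hα _

/-- The right-hand side of the equation is `π`-periodic in the angle, so `ρ(· + V) - π` solves the
same Cauchy problem. -/
theorem IsRho.add_halfPeriod {α : ℝ} (hα : α ∈ Ioo (-1 : ℝ) 1) {ρ : ℝ → ℝ} (hρ : IsRho α ρ)
    (v : ℝ) : ρ (v + halfPeriod α) = ρ v + Real.pi := by
  have h : IsRho α fun v => ρ (v + halfPeriod α) - Real.pi := by
    refine ⟨by simp [hρ.apply_halfPeriod hα], fun v => ?_⟩
    refine (((hρ.2 (v + halfPeriod α)).comp_add_const v (halfPeriod α)).sub_const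
      Real.pi).congr_deriv ?_
    rw [mul_sub, Real.sin_sub_two_pi]
  have : ρ (v + halfPeriod α) - Real.pi = ρ v := congrFun (hρ.unique hα h) v
  linarith

theorem IsRho.contDiff {α : ℝ} (hα : α ∈ Ioo (-1 : ℝ) 1) {ρ : ℝ → ℝ} (hρ : IsRho α ρ) :
    ContDiff ℝ ∞ ρ := by
  rw [contDiff_infty]
  intro n
  -- Bootstrapping: `ρ'` is a smooth function of `ρ`, so it is as regular as `ρ`.
  induction n with
  | zero =>
    exact contDiff_zero.2 (continuous_iff_continuousAt.2 fun v => (hρ.2 v).continuousAt)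
  | succ n ih =>
    refine (contDiff_succ_iff_deriv (n := n)).2 ⟨fun v => (hρ.2 v).differentiableAt, by simp, ?_⟩
    rw [funext hρ.deriv_eq]
    exact (contDiff_angleSpeed hα).comp ih

/-! ### Primitives of odd periodic functions -/

theorem even_of_hasDerivAt_odd {f g : ℝ → ℝ} (hf : ∀ v, HasDerivAt f (g v) v)
    (hg : ∀ v, g (-v) = -g v) (v : ℝ) : f (-v) = f v := by
  refine congrFun (eq_of_hasDerivAt_eq (f := fun v => f (-v)) (fun v => ?_) hf (by simp)) v
  exact ((hf (-v)).comp v (hasDerivAt_neg v)).congr_deriv (by simp [hg])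

/-- A primitive of a periodic function is periodic up to a constant increment `f V - f 0`;
evaluating at `-V` and using that `f` is even shows that the increment is zero. -/
theorem periodic_of_hasDerivAt_odd {f g : ℝ → ℝ} {V : ℝ} (hf : ∀ v, HasDerivAt f (g v) v)
    (hg : ∀ v, g (-v) = -g v) (hV : ∀ v, g (v + V) = g v) (v : ℝ) : f (v + V) = f v := by
  have h : (fun v => f (v + V) - (f V - f 0)) = f := by
    refine eq_of_hasDerivAt_eq (fun v => ?_) hf (by simp)
    simpa [hV] using ((hf (v + V)).comp_add_const v V).sub_const (f V - f 0)
  have h1 := congrFun h v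
  have h2 := congrFun h (-V)
  simp only [neg_add_cancel, even_of_hasDerivAt_odd hf hg V] at h1 h2
  linarith

theorem IsGamma.unique {α : ℝ} {ρ γ γ' : ℝ → ℝ} (hγ : IsGamma α ρ γ) (hγ' : IsGamma α ρ γ') :
    γ' = γ :=
  eq_of_hasDerivAt_eq hγ'.2 hγ.2 (hγ'.1.trans hγ.1.symm)

theorem exists_isGamma (α : ℝ) {ρ : ℝ → ℝ} (hρ : Continuous ρ) : ∃ γ, IsGamma α ρ γ := by
  have hc : Continuous fun s => -α * Real.sin (2 * ρ s) := by fun_prop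
  exact ⟨fun v => ∫ s in (0 : ℝ)..v, -α * Real.sin (2 * ρ s), by simp, fun v =>
    intervalIntegral.integral_hasDerivAt_right (hc.intervalIntegrable _ _)
    hc.aestronglyMeasurable.stronglyMeasurableAtFilter hc.continuousAt⟩

/-! ### The height function -/

/-- The derivative `F'` in terms of the angle. -/
def catSlope (α r : ℝ) : ℝ := α ^ 2 * (Real.sin (2 * r) / (1 + angleSpeed α r))

/-- The quantity `F'² + α²` in terms of the angle. -/
def catDensity (α r : ℝ) : ℝ := catSlope α r ^ 2 + α ^ 2

theorem one_add_angleSpeed_pos (α r : ℝ) : 0 < 1 + angleSpeed α r :=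
  add_pos_of_pos_of_nonneg one_pos (Real.sqrt_nonneg _)

theorem catDensity_pos {α : ℝ} (hα0 : α ≠ 0) (r : ℝ) : 0 < catDensity α r := by
  unfold catDensity; positivity

/-- With `R` the angle speed, `α² sin²(2r) = 1 - R²` factors as `(1 - R)(1 + R)`, whence `G² = α² (1
- R)/(1 + R)`. -/
theorem catDensity_mul {α : ℝ} (hα : α ∈ Ioo (-1 : ℝ) 1) (r : ℝ) :
    catDensity α r * (1 + angleSpeed α r) = 2 * α ^ 2 := by
  have h := (one_add_angleSpeed_pos α r).ne'
  have h2 := angleSpeed_sq hα r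
  rw [catDensity, catSlope]
  field_simp
  linear_combination α ^ 2 * h2

theorem catSlope_eq {α : ℝ} (hα : α ∈ Ioo (-1 : ℝ) 1) (r : ℝ) :
    catSlope α r = catDensity α r * Real.sin r * Real.cos r := by
  have h := (one_add_angleSpeed_pos α r).ne'
  have h2 := catDensity_mul hα r
  rw [catSlope, Real.sin_two_mul]
  field_simp
  linear_combination -(Real.sin r * Real.cos r) * h2

theorem angleSpeed_eq {α : ℝ} (hα : α ∈ Ioo (-1 : ℝ) 1) (r : ℝ) :
    angleSpeed α r = 1 - 2 * Real.sin r * Real.cos r * catSlope α r := by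
  have h := (one_add_angleSpeed_pos α r).ne'
  have h2 := angleSpeed_sq hα r
  rw [catSlope, ← Real.sin_two_mul]
  field_simp
  linear_combination h2

theorem catSlope_neg (α r : ℝ) : catSlope α (-r) = -catSlope α r := by
  simp [catSlope, angleSpeed_neg, neg_div]

theorem catSlope_add_pi (α r : ℝ) : catSlope α (r + Real.pi) = catSlope α r := by
  simp [catSlope, angleSpeed_add_pi, mul_add, Real.sin_add_two_pi]

theorem contDiff_catSlope {α : ℝ} (hα : α ∈ Ioo (-1 : ℝ) 1) {n : WithTop ℕ∞} :
    ContDiff ℝ n (catSlope α) :=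
  contDiff_const.mul ((Real.contDiff_sin.comp (contDiff_const.mul contDiff_id)).div
    (contDiff_const.add (contDiff_angleSpeed hα)) fun r => (one_add_angleSpeed_pos α r).ne')

section
variable {α : ℝ} {ρ γ : ℝ → ℝ}

theorem IsRho.hasDerivAt_catF (hα : α ∈ Ioo (-1 : ℝ) 1) (hρ : IsRho α ρ) (v : ℝ) :
    HasDerivAt (catF α ρ) (catSlope α (ρ v)) v := by
  have hc : Continuous fun s => Real.sin (2 * ρ s) / (1 + angleSpeed α (ρ s)) := by
    have h1 := (contDiff_angleSpeed hα (n := 0)).continuous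
    have h2 := (hρ.contDiff hα).continuous
    exact Continuous.div (by fun_prop) (by fun_prop) fun s => (one_add_angleSpeed_pos α _).ne'
  have h : catF α ρ = fun v => α ^ 2 * ∫ s in (0 : ℝ)..v,
      Real.sin (2 * ρ s) / (1 + angleSpeed α (ρ s)) := by
    funext v; simp only [catF, hρ.deriv_eq]
  rw [h]
  exact (intervalIntegral.integral_hasDerivAt_right (hc.intervalIntegrable _ _)
    hc.aestronglyMeasurable.stronglyMeasurableAtFilter hc.continuousAt).const_mul _

theorem IsRho.deriv_catF (hα : α ∈ Ioo (-1 : ℝ) 1) (hρ : IsRho α ρ) (v : ℝ) :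
    deriv (catF α ρ) v = catSlope α (ρ v) := (hρ.hasDerivAt_catF hα v).deriv

theorem catF_zero (α : ℝ) (ρ : ℝ → ℝ) : catF α ρ 0 = 0 := by simp [catF]

theorem IsRho.catF_neg (hα : α ∈ Ioo (-1 : ℝ) 1) (hρ : IsRho α ρ) (v : ℝ) :
    catF α ρ (-v) = catF α ρ v :=
  even_of_hasDerivAt_odd (hρ.hasDerivAt_catF hα) (fun v => by rw [hρ.neg hα, catSlope_neg]) v

theorem IsRho.catF_add_halfPeriod (hα : α ∈ Ioo (-1 : ℝ) 1) (hρ : IsRho α ρ) (v : ℝ) :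
    catF α ρ (v + halfPeriod α) = catF α ρ v :=
  periodic_of_hasDerivAt_odd (hρ.hasDerivAt_catF hα) (fun v => by rw [hρ.neg hα, catSlope_neg])
    (fun v => by rw [hρ.add_halfPeriod hα, catSlope_add_pi]) v

theorem IsGamma.neg (hα : α ∈ Ioo (-1 : ℝ) 1) (hρ : IsRho α ρ) (hγ : IsGamma α ρ γ) (v : ℝ) :
    γ (-v) = γ v :=
  even_of_hasDerivAt_odd hγ.2 (fun v => by simp [hρ.neg hα]) v

theorem IsGamma.add_halfPeriod (hα : α ∈ Ioo (-1 : ℝ) 1) (hρ : IsRho α ρ) (hγ : IsGamma α ρ γ)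
    (v : ℝ) : γ (v + halfPeriod α) = γ v :=
  periodic_of_hasDerivAt_odd hγ.2 (fun v => by simp [hρ.neg hα])
    (fun v => by simp [hρ.add_halfPeriod hα, mul_add, Real.sin_add_two_pi]) v

theorem IsRho.contDiff_catF (hα : α ∈ Ioo (-1 : ℝ) 1) (hρ : IsRho α ρ) :
    ContDiff ℝ ∞ (catF α ρ) := by
  refine contDiff_infty_iff_deriv.2 ⟨fun v => (hρ.hasDerivAt_catF hα v).differentiableAt, ?_⟩
  rw [funext (hρ.deriv_catF hα)]
  exact (contDiff_catSlope hα).comp (hρ.contDiff hα)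

theorem IsGamma.contDiff (hα : α ∈ Ioo (-1 : ℝ) 1) (hρ : IsRho α ρ) (hγ : IsGamma α ρ γ) :
    ContDiff ℝ ∞ γ := by
  refine contDiff_infty_iff_deriv.2 ⟨fun v => (hγ.2 v).differentiableAt, ?_⟩
  rw [funext fun v => (hγ.2 v).deriv]
  exact contDiff_const.mul (Real.contDiff_sin.comp (contDiff_const.mul (hρ.contDiff hα)))

theorem IsRho.hasDerivAt_angleSpeed (hα : α ∈ Ioo (-1 : ℝ) 1) (hρ : IsRho α ρ) (v : ℝ) :
    HasDerivAt (fun v => angleSpeed α (ρ v))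
      (-(2 * α ^ 2 * Real.sin (2 * ρ v) * Real.cos (2 * ρ v))) v := by
  have hs := angleSpeed_pos hα (ρ v)
  have h := ((((hρ.hasDerivAt v).const_mul 2).sin.pow 2).const_mul (α ^ 2)).const_sub 1
  refine (h.sqrt (angleSpeed_radicand_pos hα (ρ v)).ne').congr_deriv ?_
  -- The chain-rule factor `ρ'` cancels the square root in the denominator.
  change _ / (2 * angleSpeed α (ρ v)) = _
  field_simp
  push_cast
  ring

theorem IsRho.hasDerivAt_catSlope (hα : α ∈ Ioo (-1 : ℝ) 1) (hρ : IsRho α ρ) (v : ℝ) :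
    HasDerivAt (fun v => catSlope α (ρ v))
      (catDensity α (ρ v) * (2 * Real.cos (ρ v) ^ 2 - 1)) v := by
  have h0 := (one_add_angleSpeed_pos α (ρ v)).ne'
  have h := ((((hρ.hasDerivAt v).const_mul 2).sin).div
    ((hρ.hasDerivAt_angleSpeed hα v).const_add 1) h0).const_mul (α ^ 2)
  refine h.congr_deriv ?_
  rw [← Real.cos_two_mul]
  have h2 := angleSpeed_sq hα (ρ v)
  have h3 := catDensity_mul hα (ρ v)
  field_simp
  linear_combination (2 * α ^ 2 * Real.cos (2 * ρ v)) * h2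
     - (Real.cos (2 * ρ v) * (1 + angleSpeed α (ρ v))) * h3

end

/-! ### Partial derivatives of functions of `u + i v` -/

/-- `f` is differentiable at `z = u + i v` with `f_u = p` and `f_v = q`. -/
def HasPartials (f : ℂ → ℝ) (p q : ℝ) (z : ℂ) : Prop :=
  HasFDerivAt f (p • Complex.reCLM + q • Complex.imCLM) z

namespace HasPartials
variable {f g : ℂ → ℝ} {p q p' q' : ℝ} {z : ℂ}

theorem congr (h : HasPartials f p q z) (hp : p = p') (hq : q = q') : HasPartials f p' q' z := by
  rwa [← hp, ← hq]

theorem add (hf : HasPartials f p q z) (hg : HasPartials g p' q' z) :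
    HasPartials (fun w => f w + g w) (p + p') (q + q') z := by
  refine (HasFDerivAt.add hf hg).congr_fderiv ?_
  ext w; simp; ring

theorem sub (hf : HasPartials f p q z) (hg : HasPartials g p' q' z) :
    HasPartials (fun w => f w - g w) (p - p') (q - q') z := by
  refine (HasFDerivAt.sub hf hg).congr_fderiv ?_
  ext w; simp; ring

theorem mul (hf : HasPartials f p q z) (hg : HasPartials g p' q' z) :
    HasPartials (fun w => f w * g w) (p * g z + f z * p') (q * g z + f z * q') z := by
  refine (HasFDerivAt.mul hf hg).congr_fderiv ?_
  ext w; simp; ring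

theorem const (a : ℝ) (z : ℂ) : HasPartials (fun _ => a) 0 0 z :=
  (hasFDerivAt_const a z).congr_fderiv (by simp)

theorem const_mul (a : ℝ) (hf : HasPartials f p q z) :
    HasPartials (fun w => a * f w) (a * p) (a * q) z :=
  ((const a z).mul hf).congr (by ring) (by ring)

theorem neg (hf : HasPartials f p q z) : HasPartials (fun w => -f w) (-p) (-q) z := by
  refine (HasFDerivAt.neg hf).congr_fderiv ?_
  ext w; simp; ring

theorem comp {h : ℝ → ℝ} {d : ℝ} (hh : HasDerivAt h d (f z)) (hf : HasPartials f p q z) :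
    HasPartials (fun w => h (f w)) (d * p) (d * q) z := by
  refine (hh.comp_hasFDerivAt z hf).congr_fderiv ?_
  ext w; simp; ring

theorem exp (hf : HasPartials f p q z) :
    HasPartials (fun w => Real.exp (f w)) (Real.exp (f z) * p) (Real.exp (f z) * q) z :=
  comp (Real.hasDerivAt_exp _) hf

theorem re (z : ℂ) : HasPartials (fun w => w.re) 1 0 z :=
  Complex.reCLM.hasFDerivAt.congr_fderiv (by simp)

theorem im {h : ℝ → ℝ} {d : ℝ} {z : ℂ} (hh : HasDerivAt h d z.im) :
    HasPartials (fun w => h w.im) 0 d z := by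
  have h1 : HasPartials (fun w => w.im) 0 1 z :=
    Complex.imCLM.hasFDerivAt.congr_fderiv (by simp)
  exact (comp (f := fun w => w.im) hh h1).congr (by simp) (by simp)

theorem pi {x : ℂ → Sol3} {p q : Fin 3 → ℝ} {z : ℂ}
    (h : ∀ i, HasPartials (fun w => x w i) (p i) (q i) z) :
    HasFDerivAt x (Complex.reCLM.smulRight p + Complex.imCLM.smulRight q) z := by
  refine hasFDerivAt_pi'.2 fun i => (h i).congr_fderiv ?_
  ext w; simp; ring

theorem fderiv_one {x : ℂ → Sol3} {p q : Fin 3 → ℝ} {z : ℂ}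
    (h : ∀ i, HasPartials (fun w => x w i) (p i) (q i) z) : fderiv ℝ x z (dir 0) = p := by
  rw [(pi h).fderiv]; simp [dir]

theorem fderiv_I {x : ℂ → Sol3} {p q : Fin 3 → ℝ} {z : ℂ}
    (h : ∀ i, HasPartials (fun w => x w i) (p i) (q i) z) : fderiv ℝ x z (dir 1) = q := by
  rw [(pi h).fderiv]; simp [dir]

end HasPartials

/-! ### The Levi-Civita connection of Sol₃ -/

theorem metricMatrix_eq (p : Sol3) : metricMatrix p =
    diagonal ![Real.exp (2 * p 2), Real.exp (-(2 * p 2)), 1] := by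
  ext i j
  fin_cases i <;> fin_cases j <;> simp [metricMatrix, solMetric_eq]

theorem metricMatrix_inv (p : Sol3) : (metricMatrix p)⁻¹ =
    diagonal ![Real.exp (-(2 * p 2)), Real.exp (2 * p 2), 1] := by
  rw [metricMatrix_eq]
  refine Matrix.inv_eq_right_inv ?_
  rw [diagonal_mul_diagonal, ← diagonal_one]
  congr 1
  ext i
  fin_cases i <;> simp [← Real.exp_add]

theorem metricDeriv_eq (p : Sol3) (i j l : Fin 3) : metricDeriv p i j l =
    if i = 2 then diagonal ![2 * Real.exp (2 * p 2), -2 * Real.exp (-(2 * p 2)), 0] j l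
    else 0 := by
  have h2 : HasFDerivAt (fun q : Sol3 => 2 * q 2)
      ((2 : ℝ) • ContinuousLinearMap.proj (R := ℝ) (φ := fun _ : Fin 3 => ℝ) 2) p :=
    (hasFDerivAt_apply 2 p).const_mul 2
  have hp := h2.exp.fderiv
  have hm : fderiv ℝ (fun q : Sol3 => Real.exp (-(2 * q 2))) p = _ := h2.neg.exp.fderiv
  simp only [metricDeriv, metricMatrix_eq]
  fin_cases j <;> fin_cases l <;> fin_cases i <;> simp [hp, hm, mul_comm]

/-- The connection enters every later computation only through these three bilinear forms. -/
theorem sum_christoffel (p : Sol3) (X Y : Fin 3 → ℝ) (k : Fin 3) :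
    ∑ i, ∑ j, christoffel p k i j * X i * Y j =
      ![X 0 * Y 2 + X 2 * Y 0, -(X 1 * Y 2 + X 2 * Y 1),
        -(Real.exp (2 * p 2) * (X 0 * Y 0)) + Real.exp (-(2 * p 2)) * (X 1 * Y 1)] k := by
  have h : Real.exp (2 * p 2) * Real.exp (-(2 * p 2)) = 1 := by simp [← Real.exp_add]
  fin_cases k <;> simp [Fin.sum_univ_three, christoffel, metricMatrix_inv, metricDeriv_eq]
  · linear_combination (X 0 * Y 2 + X 2 * Y 0) * h
  · linear_combination -(X 1 * Y 2 + X 2 * Y 1) * h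
  · ring

/-! ### Conformal parametrizations -/

theorem firstForm_symm (x : ℂ → Sol3) (z : ℂ) : firstForm x z 1 0 = firstForm x z 0 1 := by
  simp [firstForm, solMetric_eq, mul_comm]

/-- The tension field `∇_{x_u} x_u + ∇_{x_v} x_v`. -/
def tension (x : ℂ → Sol3) (z : ℂ) : Fin 3 → ℝ := covD x 0 0 z + covD x 1 1 z

/-- In conformal coordinates the inverse of the first form is scalar, so the mean curvature is a
multiple of the normal component of the tension field. -/
theorem meanCurvature_eq_zero {x : ℂ → Sol3} {z : ℂ} (h1 : firstForm x z 0 0 = firstForm x z 1 1)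
    (h2 : firstForm x z 0 1 = 0) (ht : tension x z = 0) : meanCurvature x z = 0 := by
  have hI : firstForm x z = firstForm x z 1 1 • (1 : Matrix (Fin 2) (Fin 2) ℝ) := by
    ext a b
    fin_cases a <;> fin_cases b <;> simp [h1, h2, firstForm_symm x z]
  have hII : secondForm x z 0 0 + secondForm x z 1 1 = 0 := by
    have h : ∀ k, covD x 0 0 z k = -covD x 1 1 z k := fun k => by
      have := congrFun ht k
      simp only [tension, Pi.add_apply, Pi.zero_apply] at this
      linarith
    simp only [secondForm, of_apply, solMetric_eq, h]
    ring
  have hinv : (firstForm x z)⁻¹ = (firstForm x z 1 1)⁻¹ • (1 : Matrix (Fin 2) (Fin 2) ℝ) := by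
    rw [hI]
    -- A degenerate first form does no harm: the inverses of the zero matrix and of `0` are `0` by
    -- convention.
    by_cases h0 : firstForm x z 1 1 = 0
    · simp [h0]
    · refine Matrix.inv_eq_right_inv ?_
      simp [smul_smul, h0]
  rw [meanCurvature, hinv, smul_mul_assoc, one_mul, trace_smul, trace_fin_two, hII]
  simp

theorem fderiv_eq_partialD (x : ℂ → Sol3) (z w : ℂ) :
    fderiv ℝ x z w = w.re • partialD x 0 z + w.im • partialD x 1 z := by
  have h : w = w.re • (1 : ℂ) + w.im • Complex.I := by
    simp [Complex.re_add_im]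
  conv_lhs => rw [h]
  rw [map_add, map_smul, map_smul]
  rfl

theorem injective_fderiv_of_conformal {x : ℂ → Sol3} {z : ℂ} (h0 : 0 < firstForm x z 0 0)
    (h1 : firstForm x z 0 0 = firstForm x z 1 1) (h2 : firstForm x z 0 1 = 0) :
    Function.Injective (fderiv ℝ x z) := by
  refine (injective_iff_map_eq_zero _).2 fun w hw => ?_
  have h : solMetric (x z) (fderiv ℝ x z w) (fderiv ℝ x z w)
      = (w.re ^ 2 + w.im ^ 2) * firstForm x z 0 0 := by
    have e : solMetric (x z) (fderiv ℝ x z w) (fderiv ℝ x z w) = w.re ^ 2 * firstForm x z 0 0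
        + 2 * w.re * w.im * firstForm x z 0 1 + w.im ^ 2 * firstForm x z 1 1 := by
      rw [fderiv_eq_partialD]
      simp only [firstForm, of_apply, solMetric_eq, Pi.add_apply, Pi.smul_apply, smul_eq_mul]
      ring
    rw [e, ← h1, h2]; ring
  rw [hw] at h
  have h3 : w.re ^ 2 + w.im ^ 2 = 0 := by
    have : solMetric (x z) 0 0 = 0 := by simp [solMetric_eq]
    rw [this] at h
    exact (mul_eq_zero.1 h.symm).resolve_right h0.ne'
  apply Complex.ext
  · simp only [Complex.zero_re]; nlinarith [sq_nonneg w.re, sq_nonneg w.im]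
  · simp only [Complex.zero_im]; nlinarith [sq_nonneg w.re, sq_nonneg w.im]

/-! ### The partial derivatives of the catenoid immersion -/

/-- The coordinates of `x_u` in the orthonormal frame. -/
def catFrameU (α : ℝ) (ρ γ : ℝ → ℝ) (z : ℂ) : Fin 3 → ℝ :=
  ![Real.cos (ρ z.im) * catSlope α (ρ z.im) * Real.cosh (z.re + γ z.im)
      - α * Real.sin (ρ z.im) * Real.sinh (z.re + γ z.im),
    α * Real.cos (ρ z.im) * Real.sinh (z.re + γ z.im)
      + Real.sin (ρ z.im) * catSlope α (ρ z.im) * Real.cosh (z.re + γ z.im),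
    α]

/-- The coordinates of `x_v` in the orthonormal frame. -/
def catFrameV (α : ℝ) (ρ γ : ℝ → ℝ) (z : ℂ) : Fin 3 → ℝ :=
  ![-(α * Real.cos (ρ z.im) * Real.cosh (z.re + γ z.im))
      - Real.sin (ρ z.im) * catSlope α (ρ z.im) * Real.sinh (z.re + γ z.im),
    Real.cos (ρ z.im) * catSlope α (ρ z.im) * Real.sinh (z.re + γ z.im)
      - α * Real.sin (ρ z.im) * Real.cosh (z.re + γ z.im),
    catSlope α (ρ z.im)]

section
variable {α : ℝ} {ρ γ : ℝ → ℝ}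

theorem contDiff_catImmersion (hα : α ∈ Ioo (-1 : ℝ) 1) (hρ : IsRho α ρ) (hγ : IsGamma α ρ γ) :
    ContDiff ℝ ∞ (catImmersion α ρ γ) := by
  have him : ContDiff ℝ ∞ Complex.im := Complex.imCLM.contDiff
  have hre : ContDiff ℝ ∞ Complex.re := Complex.reCLM.contDiff
  have h1 : ContDiff ℝ ∞ fun z : ℂ => ρ z.im := (hρ.contDiff hα).comp him
  have h2 : ContDiff ℝ ∞ fun z : ℂ => γ z.im := (hγ.contDiff hα hρ).comp him
  have h3 : ContDiff ℝ ∞ fun z : ℂ => catF α ρ z.im := (hρ.contDiff_catF hα).comp him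
  have h4 : ContDiff ℝ ∞ fun z : ℂ => catSlope α (ρ z.im) := (contDiff_catSlope hα).comp h1
  have hc := h1.cos
  have hs := h1.sin
  have hE : ContDiff ℝ ∞ fun z : ℂ => Real.exp (z.re + γ z.im) := (hre.add h2).exp
  have hE' : ContDiff ℝ ∞ fun z : ℂ => Real.exp (-z.re - γ z.im) := (hre.neg.sub h2).exp
  refine contDiff_pi.2 fun i => ?_
  fin_cases i
  · change ContDiff ℝ ∞ fun z : ℂ => catX1 α ρ γ z.re z.im
    simp only [catX1, hρ.deriv_catF hα]
    exact ((contDiff_const.mul hre).sub h3).exp.mul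
      (((hE.div_const _).mul ((hc.mul h4).sub (contDiff_const.mul hs))).sub
        ((hE'.div_const _).mul ((contDiff_const.mul hs).add (hc.mul h4))))
  · change ContDiff ℝ ∞ fun z : ℂ => catX2 α ρ γ z.re z.im
    simp only [catX2, hρ.deriv_catF hα]
    exact ((contDiff_const.mul hre).add h3).exp.mul
      (((hE.div_const _).mul ((contDiff_const.mul hc).add (h4.mul hs))).add
        ((hE'.div_const _).mul ((contDiff_const.mul hc).sub (h4.mul hs))))
  · exact (contDiff_const.mul hre).add h3

theorem hasPartials_cos_rho (hρ : IsRho α ρ) (z : ℂ) : HasPartials (fun w => Real.cos (ρ w.im)) 0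
    (-Real.sin (ρ z.im) * angleSpeed α (ρ z.im)) z :=
  HasPartials.im (h := fun v => Real.cos (ρ v)) (hρ.hasDerivAt z.im).cos

theorem hasPartials_sin_rho (hρ : IsRho α ρ) (z : ℂ) : HasPartials (fun w => Real.sin (ρ w.im)) 0
    (Real.cos (ρ z.im) * angleSpeed α (ρ z.im)) z :=
  HasPartials.im (h := fun v => Real.sin (ρ v)) (hρ.hasDerivAt z.im).sin

theorem hasPartials_catSlope (hα : α ∈ Ioo (-1 : ℝ) 1) (hρ : IsRho α ρ) (z : ℂ) :
    HasPartials (fun w => catSlope α (ρ w.im)) 0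
      (catDensity α (ρ z.im) * (2 * Real.cos (ρ z.im) ^ 2 - 1)) z :=
  HasPartials.im (h := fun v => catSlope α (ρ v)) (hρ.hasDerivAt_catSlope hα z.im)

theorem hasPartials_catX3 (hα : α ∈ Ioo (-1 : ℝ) 1) (hρ : IsRho α ρ) (z : ℂ) :
    HasPartials (fun w => catX3 α ρ w.re w.im) α (catSlope α (ρ z.im)) z :=
  (((HasPartials.re z).const_mul α).add (HasPartials.im (hρ.hasDerivAt_catF hα z.im))).congr
    (by ring) (by ring)

theorem hasPartials_add_gamma (hγ : IsGamma α ρ γ) (z : ℂ) :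
    HasPartials (fun w => w.re + γ w.im) 1
      (-(2 * α * Real.sin (ρ z.im) * Real.cos (ρ z.im))) z :=
  ((HasPartials.re z).add (HasPartials.im (hγ.2 z.im))).congr (by ring)
    (by rw [Real.sin_two_mul]; ring)

theorem hasPartials_cosh (hγ : IsGamma α ρ γ) (z : ℂ) :
    HasPartials (fun w => Real.cosh (w.re + γ w.im)) (Real.sinh (z.re + γ z.im))
      (-(2 * α * Real.sin (ρ z.im) * Real.cos (ρ z.im)) * Real.sinh (z.re + γ z.im)) z :=
  (HasPartials.comp (Real.hasDerivAt_cosh _) (hasPartials_add_gamma hγ z)).congr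
    (by ring) (by ring)

theorem hasPartials_sinh (hγ : IsGamma α ρ γ) (z : ℂ) :
    HasPartials (fun w => Real.sinh (w.re + γ w.im)) (Real.cosh (z.re + γ z.im))
      (-(2 * α * Real.sin (ρ z.im) * Real.cos (ρ z.im)) * Real.cosh (z.re + γ z.im)) z :=
  (HasPartials.comp (Real.hasDerivAt_sinh _) (hasPartials_add_gamma hγ z)).congr
    (by ring) (by ring)

/-- In `u` the coordinate is a combination of `e^{(1-α)u}` and `e^{-(1+α)u}`, whose derivatives
absorb the denominators `1 - α` and `1 + α`. In `v` the same happens once `ρ'`, `γ'` and `F''` are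
written in terms of `sin ρ`, `cos ρ` and `G`. -/
theorem hasPartials_catX1 (hα : α ∈ Ioo (-1 : ℝ) 1) (hρ : IsRho α ρ) (hγ : IsGamma α ρ γ)
    (z : ℂ) : HasPartials (fun w => catX1 α ρ γ w.re w.im)
      (Real.exp (-catX3 α ρ z.re z.im) * catFrameU α ρ γ z 0)
      (Real.exp (-catX3 α ρ z.re z.im) * catFrameV α ρ γ z 0) z := by
  have e : (fun w : ℂ => catX1 α ρ γ w.re w.im) = fun w : ℂ =>
      Real.exp (-catX3 α ρ w.re w.im) *
        (1 / (2 * (1 - α)) * (Real.exp (w.re + γ w.im) *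
          (Real.cos (ρ w.im) * catSlope α (ρ w.im) - α * Real.sin (ρ w.im)))
        - 1 / (2 * (1 + α)) * (Real.exp (-(w.re + γ w.im)) *
          (α * Real.sin (ρ w.im) + Real.cos (ρ w.im) * catSlope α (ρ w.im)))) := by
    funext w
    rw [catX1, hρ.deriv_catF hα, catX3, show -α * w.re - catF α ρ w.im
      = -(α * w.re + catF α ρ w.im) by ring, show -w.re - γ w.im = -(w.re + γ w.im) by ring]
    ring
  rw [e]
  have hc := hasPartials_cos_rho hρ z
  have hs := hasPartials_sin_rho hρ z
  have hG := hasPartials_catSlope hα hρ z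
  have ht := hasPartials_add_gamma hγ z
  have h1 : 1 - α ≠ 0 := by linarith [hα.2]
  have h2 : 1 + α ≠ 0 := by linarith [hα.1]
  have hcs := Real.sin_sq_add_cos_sq (ρ z.im)
  refine ((hasPartials_catX3 hα hρ z).neg.exp.mul
    (((ht.exp.mul ((hc.mul hG).sub (hs.const_mul α))).const_mul (1 / (2 * (1 - α)))).sub
    ((ht.neg.exp.mul ((hs.const_mul α).add (hc.mul hG))).const_mul (1 / (2 * (1 + α)))))).congr
    ?_ ?_
  · rw [mul_assoc, ← mul_add]
    congr 1
    simp only [catFrameU, cons_val_zero, Real.cosh_eq, Real.sinh_eq]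
    field_simp
    ring
  · rw [mul_assoc, ← mul_add]
    congr 1
    simp only [catFrameV, cons_val_zero, Real.cosh_eq, Real.sinh_eq, angleSpeed_eq hα, catDensity]
    generalize Real.sin (ρ z.im) = s at *
    generalize Real.cos (ρ z.im) = c at *
    generalize catSlope α (ρ z.im) = G at *
    field_simp
    linear_combination (2 * c * (α ^ 2 + G ^ 2) *
      ((1 + α) * Real.exp (z.re + γ z.im) - (1 - α) * Real.exp (-(z.re + γ z.im)))) * hcs

theorem hasPartials_catX2 (hα : α ∈ Ioo (-1 : ℝ) 1) (hρ : IsRho α ρ) (hγ : IsGamma α ρ γ)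
    (z : ℂ) : HasPartials (fun w => catX2 α ρ γ w.re w.im)
      (Real.exp (catX3 α ρ z.re z.im) * catFrameU α ρ γ z 1)
      (Real.exp (catX3 α ρ z.re z.im) * catFrameV α ρ γ z 1) z := by
  have e : (fun w : ℂ => catX2 α ρ γ w.re w.im) = fun w : ℂ =>
      Real.exp (catX3 α ρ w.re w.im) *
        (1 / (2 * (1 + α)) * (Real.exp (w.re + γ w.im) *
          (α * Real.cos (ρ w.im) + catSlope α (ρ w.im) * Real.sin (ρ w.im)))
        + 1 / (2 * (1 - α)) * (Real.exp (-(w.re + γ w.im)) *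
          (α * Real.cos (ρ w.im) - catSlope α (ρ w.im) * Real.sin (ρ w.im)))) := by
    funext w
    rw [catX2, hρ.deriv_catF hα, catX3, show -w.re - γ w.im = -(w.re + γ w.im) by ring]
    ring
  rw [e]
  have hc := hasPartials_cos_rho hρ z
  have hs := hasPartials_sin_rho hρ z
  have hG := hasPartials_catSlope hα hρ z
  have ht := hasPartials_add_gamma hγ z
  have h1 : 1 - α ≠ 0 := by linarith [hα.2]
  have h2 : 1 + α ≠ 0 := by linarith [hα.1]
  have hcs := Real.sin_sq_add_cos_sq (ρ z.im)
  refine ((hasPartials_catX3 hα hρ z).exp.mul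
    (((ht.exp.mul ((hc.const_mul α).add (hG.mul hs))).const_mul (1 / (2 * (1 + α)))).add
    ((ht.neg.exp.mul ((hc.const_mul α).sub (hG.mul hs))).const_mul (1 / (2 * (1 - α)))))).congr
    ?_ ?_
  · rw [mul_assoc, ← mul_add]
    congr 1
    simp only [catFrameU, cons_val_zero, cons_val_one, Real.cosh_eq, Real.sinh_eq]
    field_simp
    ring
  · rw [mul_assoc, ← mul_add]
    congr 1
    simp only [catFrameV, cons_val_zero, cons_val_one, Real.cosh_eq, Real.sinh_eq,
      angleSpeed_eq hα, catDensity]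
    generalize Real.sin (ρ z.im) = s at *
    generalize Real.cos (ρ z.im) = c at *
    generalize catSlope α (ρ z.im) = G at *
    field_simp
    ring_nf

theorem hasPartials_catImmersion (hα : α ∈ Ioo (-1 : ℝ) 1) (hρ : IsRho α ρ) (hγ : IsGamma α ρ γ)
    (z : ℂ) (i : Fin 3) : HasPartials (fun w => catImmersion α ρ γ w i)
      (solM (catImmersion α ρ γ z) (catFrameU α ρ γ z) i)
      (solM (catImmersion α ρ γ z) (catFrameV α ρ γ z) i) z := by
  fin_cases i
  · exact hasPartials_catX1 hα hρ hγ z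
  · exact hasPartials_catX2 hα hρ hγ z
  · exact hasPartials_catX3 hα hρ z

theorem partialD_catImmersion_zero (hα : α ∈ Ioo (-1 : ℝ) 1) (hρ : IsRho α ρ)
    (hγ : IsGamma α ρ γ) (z : ℂ) : partialD (catImmersion α ρ γ) 0 z =
      solM (catImmersion α ρ γ z) (catFrameU α ρ γ z) :=
  HasPartials.fderiv_one (hasPartials_catImmersion hα hρ hγ z)

theorem partialD_catImmersion_one (hα : α ∈ Ioo (-1 : ℝ) 1) (hρ : IsRho α ρ)
    (hγ : IsGamma α ρ γ) (z : ℂ) : partialD (catImmersion α ρ γ) 1 z =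
      solM (catImmersion α ρ γ z) (catFrameV α ρ γ z) :=
  HasPartials.fderiv_I (hasPartials_catImmersion hα hρ hγ z)

theorem solM_solInv_solM (p : Sol3) (X : Fin 3 → ℝ) : solM (solInv p) (solM p X) = X := by
  ext i
  fin_cases i <;> simp [solM, solInv, ← mul_assoc, ← Real.exp_add]

theorem solMetric_solM (p : Sol3) (X Y : Fin 3 → ℝ) :
    solMetric p (solM p X) (solM p Y) = X ⬝ᵥ Y := by
  rw [solMetric, solM_solInv_solM, solM_solInv_solM]

/-- The conformal factor of the catenoid immersion. -/
def catFactor (α : ℝ) (ρ γ : ℝ → ℝ) (z : ℂ) : ℝ :=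
  catDensity α (ρ z.im) * Real.cosh (z.re + γ z.im) ^ 2

theorem catFactor_pos (hα0 : α ≠ 0) (z : ℂ) : 0 < catFactor α ρ γ z :=
  mul_pos (catDensity_pos hα0 _) (pow_pos (Real.cosh_pos _) 2)

theorem firstForm_catImmersion (hα : α ∈ Ioo (-1 : ℝ) 1) (hρ : IsRho α ρ)
    (hγ : IsGamma α ρ γ) (z : ℂ) :
    firstForm (catImmersion α ρ γ) z 0 0 = catFactor α ρ γ z ∧
    firstForm (catImmersion α ρ γ) z 1 1 = catFactor α ρ γ z ∧
    firstForm (catImmersion α ρ γ) z 0 1 = 0 := by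
  have hcs := Real.sin_sq_add_cos_sq (ρ z.im)
  have hh := Real.cosh_sq (z.re + γ z.im)
  have hG := catSlope_eq hα (ρ z.im)
  simp only [firstForm, of_apply, partialD_catImmersion_zero hα hρ hγ,
    partialD_catImmersion_one hα hρ hγ, solMetric_solM, dotProduct, Fin.sum_univ_three,
    catFrameU, catFrameV, catFactor, catDensity, cons_val_zero, cons_val_one, cons_val]
  rw [catDensity] at hG
  generalize Real.sin (ρ z.im) = s at *
  generalize Real.cos (ρ z.im) = c at *
  generalize catSlope α (ρ z.im) = G at *
  generalize Real.cosh (z.re + γ z.im) = C at *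
  generalize Real.sinh (z.re + γ z.im) = S at *
  refine ⟨?_, ?_, ?_⟩
  · linear_combination (G ^ 2 * C ^ 2 + α ^ 2 * S ^ 2) * hcs - α ^ 2 * hh
  · linear_combination (α ^ 2 * C ^ 2 + G ^ 2 * S ^ 2) * hcs - G ^ 2 * hh
  · linear_combination (- α * G * (C ^ 2 - S ^ 2)) * hcs - α * G * hh

theorem tension_catImmersion (hα : α ∈ Ioo (-1 : ℝ) 1) (hρ : IsRho α ρ)
    (hγ : IsGamma α ρ γ) (z : ℂ) : tension (catImmersion α ρ γ) z = 0 := by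
  have hc := hasPartials_cos_rho hρ z
  have hs := hasPartials_sin_rho hρ z
  have hG := hasPartials_catSlope hα hρ z
  have hC := hasPartials_cosh hγ z
  have hS := hasPartials_sinh hγ z
  have h3 := hasPartials_catX3 hα hρ z
  -- The second derivatives of `x` are left as placeholders, which the product rule fills in by
  -- unification.
  have hU0 : HasPartials (fun w => solM (catImmersion α ρ γ w) (catFrameU α ρ γ w) 0) _ _ z :=
    h3.neg.exp.mul (((hc.mul hG).mul hC).sub ((hs.const_mul α).mul hS))
  have hU1 : HasPartials (fun w => solM (catImmersion α ρ γ w) (catFrameU α ρ γ w) 1) _ _ z :=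
    h3.exp.mul (((hc.const_mul α).mul hS).add ((hs.mul hG).mul hC))
  have hU2 : HasPartials (fun w => solM (catImmersion α ρ γ w) (catFrameU α ρ γ w) 2) _ _ z :=
    HasPartials.const α z
  have hV0 : HasPartials (fun w => solM (catImmersion α ρ γ w) (catFrameV α ρ γ w) 0) _ _ z :=
    h3.neg.exp.mul ((((hc.const_mul α).mul hC).neg).sub ((hs.mul hG).mul hS))
  have hV1 : HasPartials (fun w => solM (catImmersion α ρ γ w) (catFrameV α ρ γ w) 1) _ _ z :=
    h3.exp.mul (((hc.mul hG).mul hS).sub ((hs.const_mul α).mul hC))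
  have hV2 : HasPartials (fun w => solM (catImmersion α ρ γ w) (catFrameV α ρ γ w) 2) _ _ z := hG
  have hU := HasPartials.fderiv_one
    (x := fun w => solM (catImmersion α ρ γ w) (catFrameU α ρ γ w)) (p := ![_, _, _])
    (q := ![_, _, _]) (Fin.forall_fin_succ.2 ⟨hU0, Fin.forall_fin_two.2 ⟨hU1, hU2⟩⟩)
  have hV := HasPartials.fderiv_I
    (x := fun w => solM (catImmersion α ρ γ w) (catFrameV α ρ γ w)) (p := ![_, _, _])
    (q := ![_, _, _]) (Fin.forall_fin_succ.2 ⟨hV0, Fin.forall_fin_two.2 ⟨hV1, hV2⟩⟩)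
  have hcs := Real.sin_sq_add_cos_sq (ρ z.im)
  have hh := Real.cosh_sq (z.re + γ z.im)
  have hR := angleSpeed_eq hα (ρ z.im)
  -- In the third component the metric coefficients meet the squares of the frame scalings; `hP` and
  -- `hQ` say that they cancel.
  have hP : Real.exp (2 * catX3 α ρ z.re z.im) * Real.exp (-catX3 α ρ z.re z.im) ^ 2 = 1 := by
    rw [← Real.exp_nat_mul, ← Real.exp_add]; simp
  have hQ : Real.exp (-(2 * catX3 α ρ z.re z.im)) * Real.exp (catX3 α ρ z.re z.im) ^ 2 = 1 := by
    rw [← Real.exp_nat_mul, ← Real.exp_add]; simp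
  ext k
  simp only [tension, Pi.add_apply, covD, funext (partialD_catImmersion_zero hα hρ hγ),
    funext (partialD_catImmersion_one hα hρ hγ), sum_christoffel, hU, hV, Pi.zero_apply]
  fin_cases k
  · simp [catImmersion, solM, catFrameU, catFrameV, hR, catDensity]
    generalize Real.sin (ρ z.im) = s at *
    generalize Real.cos (ρ z.im) = c at *
    generalize catSlope α (ρ z.im) = G at *
    ring
  · simp [catImmersion, solM, catFrameU, catFrameV, hR, catDensity]
    generalize Real.sin (ρ z.im) = s at *
    generalize Real.cos (ρ z.im) = c at *
    generalize catSlope α (ρ z.im) = G at *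
    linear_combination (2 * c * (G ^ 2 + α ^ 2) * Real.sinh (z.re + γ z.im) *
      Real.exp (catX3 α ρ z.re z.im)) * hcs
  · simp [catImmersion, solM, catFrameU, catFrameV, catDensity]
    generalize Real.sin (ρ z.im) = s at *
    generalize Real.cos (ρ z.im) = c at *
    generalize catSlope α (ρ z.im) = G at *
    generalize Real.cosh (z.re + γ z.im) = C at *
    generalize Real.sinh (z.re + γ z.im) = S at *
    linear_combination (-(c * G * C - α * s * S) ^ 2 - (-(α * c * C) - s * G * S) ^ 2) * hP
      + ((α * c * S + s * G * C) ^ 2 + (c * G * S - α * s * C) ^ 2) * hQ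
      + (G ^ 2 + α ^ 2) * hcs + (G ^ 2 + α ^ 2) * (s ^ 2 - c ^ 2) * hh

theorem gaussMap_catImmersion (hα : α ∈ Ioo (-1 : ℝ) 1) (hα0 : α ≠ 0) (hρ : IsRho α ρ)
    (hγ : IsGamma α ρ γ) (z : ℂ) :
    gaussMap (catImmersion α ρ γ) z = (catGauss ρ γ z : OnePoint ℂ) := by
  have hK := catDensity_pos hα0 (ρ z.im)
  have hC := Real.cosh_pos (z.re + γ z.im)
  have hcs := Real.sin_sq_add_cos_sq (ρ z.im)
  have hh := Real.cosh_sq (z.re + γ z.im)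
  have hcross : catFrameU α ρ γ z ⨯₃ catFrameV α ρ γ z =
      (catDensity α (ρ z.im) * Real.cosh (z.re + γ z.im)) •
        ![Real.sin (ρ z.im), -Real.cos (ρ z.im), Real.sinh (z.re + γ z.im)] := by
    rw [cross_apply]
    ext i
    fin_cases i
    · simp [catFrameU, catFrameV, catDensity]
      ring
    · simp [catFrameU, catFrameV, catDensity]
      ring
    · simp [catFrameU, catFrameV, catDensity]
      linear_combination ((catSlope α (ρ z.im) ^ 2 + α ^ 2) * Real.cosh (z.re + γ z.im) *
        Real.sinh (z.re + γ z.im)) * hcs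
  have hN : frameNormal (catImmersion α ρ γ) z = (Real.cosh (z.re + γ z.im))⁻¹ •
      ![Real.sin (ρ z.im), -Real.cos (ρ z.im), Real.sinh (z.re + γ z.im)] := by
    simp only [frameNormal, partialD_catImmersion_zero hα hρ hγ,
      partialD_catImmersion_one hα hρ hγ, solM_solInv_solM, hcross]
    have hn : ((catDensity α (ρ z.im) * Real.cosh (z.re + γ z.im)) •
        ![Real.sin (ρ z.im), -Real.cos (ρ z.im), Real.sinh (z.re + γ z.im)]) ⬝ᵥ
        ((catDensity α (ρ z.im) * Real.cosh (z.re + γ z.im)) •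
        ![Real.sin (ρ z.im), -Real.cos (ρ z.im), Real.sinh (z.re + γ z.im)]) =
        (catDensity α (ρ z.im) * Real.cosh (z.re + γ z.im) ^ 2) ^ 2 := by
      simp [dotProduct, Fin.sum_univ_three]
      linear_combination (catDensity α (ρ z.im) * Real.cosh (z.re + γ z.im)) ^ 2 * (hcs - hh)
    rw [hn, Real.sqrt_sq (by positivity), smul_smul]
    congr 1
    field_simp
  -- The value `N₃ = tanh t` never reaches `-1`, as this would force `e^t = 0`.
  have hne : ¬ ((Real.cosh (z.re + γ z.im))⁻¹ •
      ![Real.sin (ρ z.im), -Real.cos (ρ z.im), Real.sinh (z.re + γ z.im)]) 2 = -1 := fun h => by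
    simp only [Pi.smul_apply, cons_val, smul_eq_mul] at h
    have h1 : Real.sinh (z.re + γ z.im) + Real.cosh (z.re + γ z.im) = 0 := by
      field_simp at h
      linarith
    rw [Real.sinh_add_cosh] at h1
    exact (Real.exp_pos _).ne' h1
  rw [gaussMap, stereoSouth, hN, if_neg hne]
  simp only [Pi.smul_apply, cons_val, cons_val_zero, cons_val_one, smul_eq_mul]
  congr 1
  have hE : (Real.exp (z.re + γ z.im) : ℂ) ≠ 0 :=
    Complex.ofReal_ne_zero.2 (Real.exp_pos _).ne'
  have hC' : (Real.cosh (z.re + γ z.im) : ℂ) ≠ 0 := Complex.ofReal_ne_zero.2 hC.ne'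
  have hsum : (Real.cosh (z.re + γ z.im) : ℂ) + (Real.sinh (z.re + γ z.im) : ℂ)
      = (Real.exp (z.re + γ z.im) : ℂ) := by
    rw [← Complex.ofReal_add, Real.cosh_add_sinh]
  -- Since `1 + tanh t = e^t / cosh t`, the projection equals `e^{-t} (sin ρ - i cos ρ) = -i e^{-t}
  -- e^{iρ}`.
  have hden : (1 : ℂ) + ((Real.cosh (z.re + γ z.im))⁻¹ * Real.sinh (z.re + γ z.im) : ℝ)
      = (Real.cosh (z.re + γ z.im) : ℂ)⁻¹ * (Real.exp (z.re + γ z.im) : ℂ) := by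
    rw [← hsum, Complex.ofReal_mul, Complex.ofReal_inv, mul_add, inv_mul_cancel₀ hC']
  rw [hden, catGauss, show -z.re - γ z.im = -(z.re + γ z.im) by ring, Real.exp_neg,
    mul_comm Complex.I (ρ z.im : ℂ), Complex.exp_mul_I, ← Complex.ofReal_cos, ← Complex.ofReal_sin]
  simp only [Complex.ofReal_mul, Complex.ofReal_inv, Complex.ofReal_neg]
  field_simp
  linear_combination (norm := (push_cast; ring_nf)) (Real.sin (ρ z.im) : ℂ) * Complex.I_sq

end

/-! ### Plane curves whose tangent direction turns monotonically -/

section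
variable {c₀ c₁ m ρ : ℝ → ℝ} {a b V : ℝ}

/-- The signed height above the tangent line at `t` has derivative a positive multiple of `sin(ρ(v)
- ρ(t))`. It vanishes at `t`, increases up to `t + V`, then decreases until `t + 2V`, where it
vanishes again because the curve is closed. -/
theorem tangent_side_pos (hab : 0 < a * b) (hm : ∀ s t, 0 < m s * m t)
    (h₀ : ∀ v, HasDerivAt c₀ (m v * (a * Real.cos (ρ v))) v)
    (h₁ : ∀ v, HasDerivAt c₁ (m v * (b * Real.sin (ρ v))) v)
    (hρ : StrictMono ρ) (hV : ∀ v, ρ (v + V) = ρ v + Real.pi)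
    (p₀ : ∀ v, c₀ (v + 2 * V) = c₀ v) (p₁ : ∀ v, c₁ (v + 2 * V) = c₁ v)
    {s t : ℝ} (hs : t < s) (hs' : s < t + 2 * V) :
    0 < m t * (a * Real.cos (ρ t)) * (c₁ s - c₁ t) - m t * (b * Real.sin (ρ t)) * (c₀ s - c₀ t) := by
  set h : ℝ → ℝ := fun v => m t * (a * Real.cos (ρ t)) * (c₁ v - c₁ t)
    - m t * (b * Real.sin (ρ t)) * (c₀ v - c₀ t) with hh
  have hd : ∀ v, HasDerivAt h (m t * m v * (a * b) * Real.sin (ρ v - ρ t)) v := fun v => by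
    refine ((((h₁ v).sub_const _).const_mul _).sub (((h₀ v).sub_const _).const_mul _)).congr_deriv ?_
    rw [Real.sin_sub]; ring
  have hcont : Continuous h := continuous_iff_continuousAt.2 fun v => (hd v).continuousAt
  have ht : h t = 0 := by simp [hh]
  have ht' : h (t + 2 * V) = 0 := by simp [hh, p₀, p₁]
  change 0 < h s
  rcases le_or_gt s (t + V) with hsV | hsV
  · have hmono : StrictMonoOn h (Icc t (t + V)) := by
      refine strictMonoOn_of_deriv_pos (convex_Icc _ _) hcont.continuousOn fun v hv => ?_
      rw [interior_Icc] at hv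
      rw [(hd v).deriv]
      refine mul_pos (mul_pos (hm t v) hab) (Real.sin_pos_of_pos_of_lt_pi ?_ ?_)
      · linarith [hρ hv.1]
      · linarith [hρ hv.2, hV t]
    have := hmono (left_mem_Icc.2 (hs.le.trans hsV)) ⟨hs.le, hsV⟩ hs
    rwa [ht] at this
  · have hanti : StrictAntiOn h (Icc (t + V) (t + 2 * V)) := by
      refine strictAntiOn_of_deriv_neg (convex_Icc _ _) hcont.continuousOn fun v hv => ?_
      rw [interior_Icc] at hv
      rw [(hd v).deriv]
      refine mul_neg_of_pos_of_neg (mul_pos (hm t v) hab) ?_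
      have e : Real.sin (ρ v - ρ t) = -Real.sin (ρ v - ρ t - Real.pi) := by
        rw [Real.sin_sub_pi, neg_neg]
      rw [e, neg_lt_zero]
      have h2 : ρ (t + 2 * V) = ρ t + 2 * Real.pi := by
        rw [show t + 2 * V = t + V + V by ring, hV, hV]; ring
      exact Real.sin_pos_of_pos_of_lt_pi (by linarith [hρ hv.1, hV t]) (by linarith [hρ hv.2])
    have := hanti ⟨hsV.le, hs'.le⟩ (right_mem_Icc.2 (by linarith)) hs'
    rwa [ht'] at this

theorem tangent_side_cases (hVpos : 0 < V) (hab : 0 < a * b) (hm : ∀ s t, 0 < m s * m t)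
    (h₀ : ∀ v, HasDerivAt c₀ (m v * (a * Real.cos (ρ v))) v)
    (h₁ : ∀ v, HasDerivAt c₁ (m v * (b * Real.sin (ρ v))) v)
    (hρ : StrictMono ρ) (hV : ∀ v, ρ (v + V) = ρ v + Real.pi)
    (p₀ : Function.Periodic c₀ (2 * V)) (p₁ : Function.Periodic c₁ (2 * V)) (s t : ℝ) :
    (∃ k : ℤ, s = t + k * (2 * V)) ∨
    0 < m t * (a * Real.cos (ρ t)) * (c₁ s - c₁ t) - m t * (b * Real.sin (ρ t)) * (c₀ s - c₀ t) := by
  -- Translate `s` by periods into `[t, t + 2V)`; the left endpoint is the case of the same point.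
  obtain ⟨k, hk, -⟩ := existsUnique_add_zsmul_mem_Ico (show 0 < 2 * V by linarith) s t
  rw [zsmul_eq_mul] at hk
  rcases hk.1.eq_or_lt with h | h
  · exact Or.inl ⟨-k, by push_cast; linarith⟩
  · right
    have := tangent_side_pos hab hm h₀ h₁ hρ hV p₀ p₁ h hk.2
    rwa [p₀.int_mul k s, p₁.int_mul k s] at this

end

theorem HasPartials.comp_curve {f : ℂ → ℝ} {p q d : ℝ} {u : ℝ → ℝ} {v : ℝ}
    (hu : HasDerivAt u d v) (hf : HasPartials f p q ((u v : ℂ) + v * Complex.I)) :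
    HasDerivAt (fun s : ℝ => f ((u s : ℂ) + s * Complex.I)) (p * d + q) v := by
  have h : HasDerivAt (fun s : ℝ => (u s : ℂ) + s * Complex.I) (d + (1 : ℝ) * Complex.I) v :=
    hu.ofReal_comp.add ((hasDerivAt_id v).ofReal_comp.mul_const Complex.I)
  refine (HasFDerivAt.comp_hasDerivAt (f := fun s : ℝ => (u s : ℂ) + s * Complex.I) v hf
    h).congr_deriv ?_
  simp

section
variable {α : ℝ} {ρ γ : ℝ → ℝ}

/-! ### Symmetries of the immersion -/

theorem catImmersion_add_halfPeriod (hα : α ∈ Ioo (-1 : ℝ) 1) (hρ : IsRho α ρ)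
    (hγ : IsGamma α ρ γ) (z : ℂ) :
    catImmersion α ρ γ (z + Complex.I * halfPeriod α) = rotationX3 (catImmersion α ρ γ z) := by
  ext i
  fin_cases i <;>
    simp [catImmersion, rotationX3, catX1, catX2, catX3, hρ.deriv_catF hα, hρ.add_halfPeriod hα,
      hγ.add_halfPeriod hα hρ, hρ.catF_add_halfPeriod hα, catSlope_add_pi] <;> ring

theorem catImmersion_add_period (hα : α ∈ Ioo (-1 : ℝ) 1) (hρ : IsRho α ρ)
    (hγ : IsGamma α ρ γ) (z : ℂ) :
    catImmersion α ρ γ (z + 2 * Complex.I * halfPeriod α) = catImmersion α ρ γ z := by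
  rw [show z + 2 * Complex.I * (halfPeriod α : ℂ) = z + Complex.I * halfPeriod α
    + Complex.I * halfPeriod α by ring, catImmersion_add_halfPeriod hα hρ hγ,
    catImmersion_add_halfPeriod hα hρ hγ]
  ext i
  fin_cases i <;> simp [rotationX3]

theorem periodic_catImmersion (hα : α ∈ Ioo (-1 : ℝ) 1) (hρ : IsRho α ρ)
    (hγ : IsGamma α ρ γ) :
    Function.Periodic (catImmersion α ρ γ) (2 * Complex.I * halfPeriod α) :=
  catImmersion_add_period hα hρ hγ

theorem catImmersion_conj (hα : α ∈ Ioo (-1 : ℝ) 1) (hρ : IsRho α ρ)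
    (hγ : IsGamma α ρ γ) (z : ℂ) :
    catImmersion α ρ γ (starRingEnd ℂ z) = reflectionX1 (catImmersion α ρ γ z) := by
  ext i
  fin_cases i <;>
    simp [catImmersion, reflectionX1, catX1, catX2, catX3, hρ.deriv_catF hα, hρ.neg hα,
      hγ.neg hα hρ, hρ.catF_neg hα, catSlope_neg]
  ring

theorem image_rotationX3_catenoid (hα : α ∈ Ioo (-1 : ℝ) 1) (hρ : IsRho α ρ)
    (hγ : IsGamma α ρ γ) : rotationX3 '' catenoid α ρ γ = catenoid α ρ γ := by
  rw [catenoid, ← range_comp, ← (Equiv.addRight (Complex.I * (halfPeriod α : ℂ))).surjective.range_comp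
    (catImmersion α ρ γ)]
  congr 1
  funext z
  exact (catImmersion_add_halfPeriod hα hρ hγ z).symm

theorem image_reflectionX1_catenoid (hα : α ∈ Ioo (-1 : ℝ) 1) (hρ : IsRho α ρ)
    (hγ : IsGamma α ρ γ) : reflectionX1 '' catenoid α ρ γ = catenoid α ρ γ := by
  rw [catenoid, ← range_comp, ← (star_involutive (R := ℂ)).surjective.range_comp
    (catImmersion α ρ γ)]
  congr 1
  funext z
  exact (catImmersion_conj hα hρ hγ z).symm

theorem image_reflectionX2_catenoid (hα : α ∈ Ioo (-1 : ℝ) 1) (hρ : IsRho α ρ)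
    (hγ : IsGamma α ρ γ) : reflectionX2 '' catenoid α ρ γ = catenoid α ρ γ := by
  have h : reflectionX2 = rotationX3 ∘ reflectionX1 := by
    funext x; ext i
    fin_cases i <;> simp [reflectionX2, rotationX3, reflectionX1]
  rw [h, image_comp, image_reflectionX1_catenoid hα hρ hγ, image_rotationX3_catenoid hα hρ hγ]

/-! ### Horizontal slices -/

/-- The parameter of the point with second parameter `v` of the slice at height `l`. -/
def sliceParam (α : ℝ) (ρ : ℝ → ℝ) (l v : ℝ) : ℂ :=
  (((l - catF α ρ v) / α : ℝ) : ℂ) + v * Complex.I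

/-- The slice at height `l`, as a parametrized curve. -/
def sliceCurve (α : ℝ) (ρ γ : ℝ → ℝ) (l v : ℝ) : Fin 2 → ℝ :=
  ![catImmersion α ρ γ (sliceParam α ρ l v) 0, catImmersion α ρ γ (sliceParam α ρ l v) 1]

/-- The signed speed of the slices with respect to the direction of angle `ρ`. -/
def sliceSpeed (α : ℝ) (ρ γ : ℝ → ℝ) (l v : ℝ) : ℝ :=
  -(catDensity α (ρ v) * Real.cosh ((l - catF α ρ v) / α + γ v) / α)

theorem sliceParam_re (α : ℝ) (ρ : ℝ → ℝ) (l v : ℝ) :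
    (sliceParam α ρ l v).re = (l - catF α ρ v) / α := by simp [sliceParam]

theorem sliceParam_im (α : ℝ) (ρ : ℝ → ℝ) (l v : ℝ) : (sliceParam α ρ l v).im = v := by
  simp [sliceParam]

theorem catImmersion_sliceParam_two (hα0 : α ≠ 0) (ρ γ : ℝ → ℝ) (l v : ℝ) :
    catImmersion α ρ γ (sliceParam α ρ l v) 2 = l := by
  simp [catImmersion, catX3, sliceParam_re, sliceParam_im]
  field_simp
  ring

theorem catImmersion_sliceParam (hα0 : α ≠ 0) (ρ γ : ℝ → ℝ) (l v : ℝ) :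
    catImmersion α ρ γ (sliceParam α ρ l v) =
      ![sliceCurve α ρ γ l v 0, sliceCurve α ρ γ l v 1, l] := by
  ext i
  fin_cases i
  · rfl
  · rfl
  · exact catImmersion_sliceParam_two hα0 ρ γ l v

theorem eq_sliceParam (hα0 : α ≠ 0) {ρ γ : ℝ → ℝ} {l : ℝ} {z : ℂ}
    (h : catImmersion α ρ γ z 2 = l) : z = sliceParam α ρ l z.im := by
  have h' : α * z.re + catF α ρ z.im = l := h
  apply Complex.ext
  · rw [sliceParam_re, ← h']; field_simp; ring
  · rw [sliceParam_im]

theorem range_sliceCurve (hα0 : α ≠ 0) (ρ γ : ℝ → ℝ) (l : ℝ) :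
    range (sliceCurve α ρ γ l) = slice (catenoid α ρ γ) l := by
  ext p
  constructor
  · rintro ⟨v, rfl⟩
    exact ⟨sliceParam α ρ l v, catImmersion_sliceParam hα0 ρ γ l v⟩
  · rintro ⟨z, hz⟩
    have h := eq_sliceParam hα0 (l := l) (congrFun hz 2)
    refine ⟨z.im, ?_⟩
    ext i
    fin_cases i
    · simpa [sliceCurve, ← h] using congrFun hz 0
    · simpa [sliceCurve, ← h] using congrFun hz 1

theorem sliceParam_add_period (hα : α ∈ Ioo (-1 : ℝ) 1) (hρ : IsRho α ρ) (l v : ℝ) :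
    sliceParam α ρ l (v + 2 * halfPeriod α) =
      sliceParam α ρ l v + 2 * Complex.I * halfPeriod α := by
  rw [sliceParam, two_mul, ← add_assoc, hρ.catF_add_halfPeriod hα, hρ.catF_add_halfPeriod hα,
    sliceParam]
  push_cast
  ring

theorem periodic_sliceCurve (hα : α ∈ Ioo (-1 : ℝ) 1) (hρ : IsRho α ρ) (hγ : IsGamma α ρ γ)
    (l : ℝ) : Function.Periodic (sliceCurve α ρ γ l) (2 * halfPeriod α) := fun v => by
  rw [sliceCurve, sliceParam_add_period hα hρ, catImmersion_add_period hα hρ hγ, sliceCurve]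

theorem hasDerivAt_sliceHeight (hα : α ∈ Ioo (-1 : ℝ) 1) (hρ : IsRho α ρ) (l v : ℝ) :
    HasDerivAt (fun v => (l - catF α ρ v) / α) (-catSlope α (ρ v) / α) v :=
  ((hρ.hasDerivAt_catF hα v).const_sub l).div_const α

/-- The velocity is `x_v - (G/α) x_u`: the `sinh` terms cancel and the `cosh` terms combine into `K
cosh t`. -/
theorem hasDerivAt_sliceCurve_zero (hα : α ∈ Ioo (-1 : ℝ) 1) (hα0 : α ≠ 0) (hρ : IsRho α ρ)
    (hγ : IsGamma α ρ γ) (l v : ℝ) : HasDerivAt (fun v => sliceCurve α ρ γ l v 0)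
      (sliceSpeed α ρ γ l v * (Real.exp (-l) * Real.cos (ρ v))) v := by
  have h := HasPartials.comp_curve (hasDerivAt_sliceHeight hα hρ l v)
    (hasPartials_catImmersion hα hρ hγ (sliceParam α ρ l v) 0)
  refine h.congr_deriv ?_
  simp only [solM, catImmersion_sliceParam_two hα0, catFrameU, catFrameV, cons_val_zero,
    sliceParam_re, sliceParam_im, sliceSpeed, catDensity]
  field_simp
  ring

theorem hasDerivAt_sliceCurve_one (hα : α ∈ Ioo (-1 : ℝ) 1) (hα0 : α ≠ 0) (hρ : IsRho α ρ)
    (hγ : IsGamma α ρ γ) (l v : ℝ) : HasDerivAt (fun v => sliceCurve α ρ γ l v 1)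
      (sliceSpeed α ρ γ l v * (Real.exp l * Real.sin (ρ v))) v := by
  have h := HasPartials.comp_curve (hasDerivAt_sliceHeight hα hρ l v)
    (hasPartials_catImmersion hα hρ hγ (sliceParam α ρ l v) 1)
  refine h.congr_deriv ?_
  simp only [solM, catImmersion_sliceParam_two hα0, catFrameU, catFrameV, cons_val_zero,
    cons_val_one, sliceParam_re, sliceParam_im, sliceSpeed, catDensity]
  field_simp
  ring

theorem sliceSpeed_mul_pos (hα0 : α ≠ 0) (ρ γ : ℝ → ℝ) (l s t : ℝ) :
    0 < sliceSpeed α ρ γ l s * sliceSpeed α ρ γ l t := by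
  have h1 := catDensity_pos hα0 (ρ s)
  have h2 := catDensity_pos hα0 (ρ t)
  have h3 := Real.cosh_pos ((l - catF α ρ s) / α + γ s)
  have h4 := Real.cosh_pos ((l - catF α ρ t) / α + γ t)
  have h5 : 0 < α ^ 2 := by positivity
  have e : sliceSpeed α ρ γ l s * sliceSpeed α ρ γ l t =
      catDensity α (ρ s) * Real.cosh ((l - catF α ρ s) / α + γ s) *
      (catDensity α (ρ t) * Real.cosh ((l - catF α ρ t) / α + γ t)) / α ^ 2 := by
    simp only [sliceSpeed]; field_simp
  rw [e]
  positivity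

theorem sliceCurve_tangent_side (hα : α ∈ Ioo (-1 : ℝ) 1) (hα0 : α ≠ 0) (hρ : IsRho α ρ)
    (hγ : IsGamma α ρ γ) (l s t : ℝ) :
    (∃ k : ℤ, s = t + k * (2 * halfPeriod α)) ∨
    0 < sliceSpeed α ρ γ l t * (Real.exp (-l) * Real.cos (ρ t)) *
        (sliceCurve α ρ γ l s 1 - sliceCurve α ρ γ l t 1)
      - sliceSpeed α ρ γ l t * (Real.exp l * Real.sin (ρ t)) *
        (sliceCurve α ρ γ l s 0 - sliceCurve α ρ γ l t 0) :=
  tangent_side_cases (c₀ := fun v => sliceCurve α ρ γ l v 0)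
    (c₁ := fun v => sliceCurve α ρ γ l v 1) (halfPeriod_pos hα) (by positivity)
    (sliceSpeed_mul_pos hα0 ρ γ l) (hasDerivAt_sliceCurve_zero hα hα0 hρ hγ l)
    (hasDerivAt_sliceCurve_one hα hα0 hρ hγ l) (hρ.strictMono hα) (hρ.add_halfPeriod hα)
    (fun v => congrFun (periodic_sliceCurve hα hρ hγ l v) 0)
    (fun v => congrFun (periodic_sliceCurve hα hρ hγ l v) 1) s t

theorem sliceCurve_eq_iff (hα : α ∈ Ioo (-1 : ℝ) 1) (hα0 : α ≠ 0) (hρ : IsRho α ρ)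
    (hγ : IsGamma α ρ γ) (l s t : ℝ) : sliceCurve α ρ γ l s = sliceCurve α ρ γ l t ↔
      ∃ k : ℤ, s = t + k * (2 * halfPeriod α) := by
  constructor
  · intro h
    -- For two parameters of the same point the strict inequality would read `0 < 0`.
    refine (sliceCurve_tangent_side hα hα0 hρ hγ l s t).resolve_right ?_
    simp [h]
  · rintro ⟨k, rfl⟩
    exact (periodic_sliceCurve hα hρ hγ l).int_mul k t

theorem isClosedEmbeddedConvexCurve_slice (hα : α ∈ Ioo (-1 : ℝ) 1) (hα0 : α ≠ 0)
    (hρ : IsRho α ρ) (hγ : IsGamma α ρ γ) (l : ℝ) :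
    IsClosedEmbeddedConvexCurve (slice (catenoid α ρ γ) l) := by
  have hd : ∀ v, HasDerivAt (sliceCurve α ρ γ l)
      ![sliceSpeed α ρ γ l v * (Real.exp (-l) * Real.cos (ρ v)),
        sliceSpeed α ρ γ l v * (Real.exp l * Real.sin (ρ v))] v := fun v =>
    hasDerivAt_pi.2 (Fin.forall_fin_two.2 ⟨hasDerivAt_sliceCurve_zero hα hα0 hρ hγ l v,
      hasDerivAt_sliceCurve_one hα hα0 hρ hγ l v⟩)
  refine ⟨sliceCurve α ρ γ l, 2 * halfPeriod α, by linarith [halfPeriod_pos hα], ?_, ?_,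
    sliceCurve_eq_iff hα hα0 hρ hγ l, range_sliceCurve hα0 ρ γ l, ?_⟩
  · have hp : ContDiff ℝ ∞ (sliceParam α ρ l) :=
      (Complex.ofRealCLM.contDiff.comp
        ((contDiff_const.sub (hρ.contDiff_catF hα)).div_const α)).add
        (Complex.ofRealCLM.contDiff.mul contDiff_const)
    have hx := (contDiff_catImmersion hα hρ hγ).comp hp
    refine contDiff_pi.2 (Fin.forall_fin_two.2 ⟨contDiff_pi.1 hx 0, contDiff_pi.1 hx 1⟩)
  · intro t ht
    rw [(hd t).deriv] at ht
    have hm := sliceSpeed_mul_pos hα0 ρ γ l t t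
    have hm' : sliceSpeed α ρ γ l t ≠ 0 := fun h => by simp [h] at hm
    have e0 := congrFun ht 0
    have e1 := congrFun ht 1
    simp [hm'] at e0 e1
    have := Real.sin_sq_add_cos_sq (ρ t)
    simp [e0, e1] at this
  · intro t
    left
    intro s
    rw [(hd t).deriv]
    rcases sliceCurve_tangent_side hα hα0 hρ hγ l s t with ⟨k, hk⟩ | h
    · rw [(sliceCurve_eq_iff hα hα0 hρ hγ l s t).2 ⟨k, hk⟩]
      simp
    · exact h.le

theorem catImmersion_eq_iff (hα : α ∈ Ioo (-1 : ℝ) 1) (hα0 : α ≠ 0) (hρ : IsRho α ρ)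
    (hγ : IsGamma α ρ γ) (z w : ℂ) : catImmersion α ρ γ z = catImmersion α ρ γ w ↔
      ∃ k : ℤ, z = w + k * (2 * Complex.I * halfPeriod α) := by
  constructor
  · intro h
    have hz := eq_sliceParam hα0 (congrFun h 2)
    have hw : w = sliceParam α ρ (catImmersion α ρ γ w 2) w.im := eq_sliceParam hα0 rfl
    set l := catImmersion α ρ γ w 2
    have hc : sliceCurve α ρ γ l z.im = sliceCurve α ρ γ l w.im := by
      rw [sliceCurve, sliceCurve, ← hz, ← hw, h]
    obtain ⟨k, hk⟩ := (sliceCurve_eq_iff hα hα0 hρ hγ l _ _).1 hc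
    have hF : catF α ρ z.im = catF α ρ w.im := by
      have hp : Function.Periodic (catF α ρ) (2 * halfPeriod α) := fun v => by
        rw [two_mul, ← add_assoc, hρ.catF_add_halfPeriod hα, hρ.catF_add_halfPeriod hα]
      rw [hk]
      exact hp.int_mul k _
    refine ⟨k, ?_⟩
    have e : sliceParam α ρ l z.im =
        sliceParam α ρ l w.im + k * (2 * Complex.I * halfPeriod α) := by
      rw [sliceParam, hF, hk, sliceParam]
      push_cast
      ring
    rw [← hw] at e
    exact hz.trans e
  · rintro ⟨k, rfl⟩
    exact (periodic_catImmersion hα hρ hγ).int_mul k w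

end

/-! ### Holomorphic reparametrizations -/

section
variable {x φ : ℂ → Sol3} {h k : ℂ → ℂ} {ζ : ℂ}

theorem partialD_reparam (hx : ContDiff ℝ ∞ x) (hφ : φ =ᶠ[𝓝 ζ] fun w => x (h w))
    (hh : HasDerivAt h (k ζ) ζ) (a : Fin 2) :
    partialD φ a ζ = fderiv ℝ x (h ζ) (k ζ * dir a) := by
  have hd : HasFDerivAt x (fderiv ℝ x (h ζ)) (h ζ) :=
    (hx.differentiable (by simp) (h ζ)).hasFDerivAt
  have h1 : HasFDerivAt (fun w => x (h w)) _ ζ :=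
    hd.comp ζ (hh.hasFDerivAt.restrictScalars ℝ)
  rw [partialD, hφ.fderiv_eq, h1.fderiv]
  simp [mul_comm]

theorem partialD_reparam_zero (hx : ContDiff ℝ ∞ x) (hφ : φ =ᶠ[𝓝 ζ] fun w => x (h w))
    (hh : HasDerivAt h (k ζ) ζ) : partialD φ 0 ζ =
      (k ζ).re • partialD x 0 (h ζ) + (k ζ).im • partialD x 1 (h ζ) := by
  rw [partialD_reparam hx hφ hh, fderiv_eq_partialD]
  simp [dir]

theorem partialD_reparam_one (hx : ContDiff ℝ ∞ x) (hφ : φ =ᶠ[𝓝 ζ] fun w => x (h w))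
    (hh : HasDerivAt h (k ζ) ζ) : partialD φ 1 ζ =
      -(k ζ).im • partialD x 0 (h ζ) + (k ζ).re • partialD x 1 (h ζ) := by
  rw [partialD_reparam hx hφ hh, fderiv_eq_partialD]
  simp [dir]

theorem firstForm_reparam (hx : ContDiff ℝ ∞ x) (hφ : φ =ᶠ[𝓝 ζ] fun w => x (h w))
    (hh : HasDerivAt h (k ζ) ζ) (h1 : firstForm x (h ζ) 0 0 = firstForm x (h ζ) 1 1)
    (h2 : firstForm x (h ζ) 0 1 = 0) :
    firstForm φ ζ 0 0 = Complex.normSq (k ζ) * firstForm x (h ζ) 0 0 ∧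
    firstForm φ ζ 1 1 = Complex.normSq (k ζ) * firstForm x (h ζ) 0 0 ∧
    firstForm φ ζ 0 1 = 0 := by
  simp only [firstForm, of_apply, solMetric_eq, Complex.normSq_apply] at h1 h2 ⊢
  rw [partialD_reparam_zero hx hφ hh, partialD_reparam_one hx hφ hh, hφ.self_of_nhds]
  simp only [Pi.add_apply, Pi.smul_apply, smul_eq_mul]
  refine ⟨?_, ?_, ?_⟩
  · linear_combination 2 * (k ζ).re * (k ζ).im * h2 - (k ζ).im ^ 2 * h1
  · linear_combination -2 * (k ζ).re * (k ζ).im * h2 - (k ζ).re ^ 2 * h1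
  · linear_combination ((k ζ).re ^ 2 - (k ζ).im ^ 2) * h2 - (k ζ).re * (k ζ).im * h1

theorem tension_eq (hx : ContDiff ℝ ∞ x) (z : ℂ) (i : Fin 3) : tension x z i =
    fderiv ℝ (fderiv ℝ x) z 1 1 i + fderiv ℝ (fderiv ℝ x) z Complex.I Complex.I i
    + ![partialD x 0 z 0 * partialD x 0 z 2 + partialD x 0 z 2 * partialD x 0 z 0,
        -(partialD x 0 z 1 * partialD x 0 z 2 + partialD x 0 z 2 * partialD x 0 z 1),
        -(Real.exp (2 * x z 2) * (partialD x 0 z 0 * partialD x 0 z 0))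
          + Real.exp (-(2 * x z 2)) * (partialD x 0 z 1 * partialD x 0 z 1)] i
    + ![partialD x 1 z 0 * partialD x 1 z 2 + partialD x 1 z 2 * partialD x 1 z 0,
        -(partialD x 1 z 1 * partialD x 1 z 2 + partialD x 1 z 2 * partialD x 1 z 1),
        -(Real.exp (2 * x z 2) * (partialD x 1 z 0 * partialD x 1 z 0))
          + Real.exp (-(2 * x z 2)) * (partialD x 1 z 1 * partialD x 1 z 1)] i := by
  have hd : HasFDerivAt (fderiv ℝ x) (fderiv ℝ (fderiv ℝ x) z) z :=
    (((hx.fderiv_right (m := 1) (by norm_cast)).differentiable (by simp)) z).hasFDerivAt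
  have h2 : ∀ a, fderiv ℝ (fun w => partialD x a w) z (dir a)
      = fderiv ℝ (fderiv ℝ x) z (dir a) (dir a) := fun a => by
    have := hd.clm_apply (hasFDerivAt_const (dir a) z)
    change fderiv ℝ (fun w => fderiv ℝ x w (dir a)) z (dir a) = _
    rw [this.fderiv]
    simp
  simp only [tension, Pi.add_apply, covD, h2, sum_christoffel]
  simp only [dir, cons_val_zero, cons_val_one]
  ring

/-- The tension field is conformally covariant. The quadratic terms are summed over the pair `k`,
`ik`, which is a rotated and scaled copy of `1`, `i`, and yield `|k|²`; the terms in `h''` cancel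
because `1 + i² = 0`, that is, because `h` is harmonic. -/
theorem tension_reparam (hx : ContDiff ℝ ∞ x) (hφ : φ =ᶠ[𝓝 ζ] fun w => x (h w))
    (hh : ∀ᶠ w in 𝓝 ζ, HasDerivAt h (k w) w) {k' : ℂ} (hk : HasDerivAt k k' ζ) :
    tension φ ζ = Complex.normSq (k ζ) • tension x (h ζ) := by
  set B := fderiv ℝ (fderiv ℝ x) (h ζ) with hB
  have hd : HasFDerivAt (fderiv ℝ x) B (h ζ) :=
    (((hx.fderiv_right (m := 1) (by norm_cast)).differentiable (by simp)) (h ζ)).hasFDerivAt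
  have h1 : ∀ a, fderiv ℝ (fun w => partialD φ a w) ζ (dir a)
      = B (k ζ * dir a) (k ζ * dir a) + fderiv ℝ x (h ζ) (k' * dir a * dir a) := fun a => by
    have e : (fun w => partialD φ a w) =ᶠ[𝓝 ζ] fun w => fderiv ℝ x (h w) (k w * dir a) := by
      filter_upwards [hφ.eventuallyEq_nhds, hh] with w hw hw'
      exact partialD_reparam hx hw hw' a
    have d1 : HasFDerivAt (fun w => fderiv ℝ x (h w)) _ ζ :=
      hd.comp ζ (hh.self_of_nhds.hasFDerivAt.restrictScalars ℝ)
    have d2 := d1.clm_apply ((hk.mul_const (dir a)).hasFDerivAt.restrictScalars ℝ)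
    rw [e.fderiv_eq, d2.fderiv]
    simp [mul_comm, mul_left_comm, add_comm]
  have e0 : k ζ * dir 0 = (k ζ).re • (1 : ℂ) + (k ζ).im • Complex.I := by
    simp [dir, Complex.re_add_im]
  have e1 : k ζ * dir 1 = (-(k ζ).im) • (1 : ℂ) + (k ζ).re • Complex.I := by
    apply Complex.ext <;> simp [dir]
  have e2 : fderiv ℝ x (h ζ) (k' * dir 0 * dir 0) + fderiv ℝ x (h ζ) (k' * dir 1 * dir 1) = 0 := by
    rw [← map_add, show k' * dir 0 * dir 0 + k' * dir 1 * dir 1 = 0 by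
      simp only [dir, cons_val_zero, cons_val_one]
      linear_combination k' * Complex.I_mul_I, map_zero]
  have p0 := partialD_reparam_zero hx hφ hh.self_of_nhds
  have p1 := partialD_reparam_one hx hφ hh.self_of_nhds
  ext i
  have e2i := congrFun e2 i
  simp only [Pi.add_apply, Pi.zero_apply] at e2i
  rw [Pi.smul_apply, tension_eq hx, ← hB]
  simp only [tension, Pi.add_apply, covD, h1, sum_christoffel, e0, e1, map_add, map_smul,
    _root_.add_apply, _root_.smul_apply, Pi.smul_apply, smul_eq_mul,
    p0, p1, hφ.self_of_nhds, Complex.normSq_apply]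
  fin_cases i
  all_goals
    simp only [Fin.zero_eta, Fin.mk_one, Fin.reduceFinMk, cons_val_zero, cons_val_one,
      cons_val] at e2i ⊢
    linear_combination e2i

end

/-! ### The catenoid as a conformal annulus -/

/-- The catenoid immersion in the coordinate `ζ = e^{π z / V}`. -/
def annulusMap (α : ℝ) (ρ γ : ℝ → ℝ) (ζ : ℂ) : Sol3 :=
  catImmersion α ρ γ ((halfPeriod α / Real.pi : ℂ) * Complex.log ζ)

section
variable {α : ℝ} {ρ γ : ℝ → ℝ}

/-- Two logarithms of `ζ` differ by a multiple of `2πi`, hence by a period of `x` after scaling by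
`V/π`. The free parameter `w` selects the branch. -/
theorem annulusMap_eq (hα : α ∈ Ioo (-1 : ℝ) 1) (hρ : IsRho α ρ) (hγ : IsGamma α ρ γ)
    (w : ℂ) {ζ : ℂ} (hζ : ζ ≠ 0) : annulusMap α ρ γ ζ = catImmersion α ρ γ
      ((halfPeriod α / Real.pi : ℂ) * (w + Complex.log (ζ * Complex.exp (-w)))) := by
  have h : Complex.exp (Complex.log ζ) =
      Complex.exp (w + Complex.log (ζ * Complex.exp (-w))) := by
    rw [Complex.exp_add, Complex.exp_log hζ,
      Complex.exp_log (mul_ne_zero hζ (Complex.exp_ne_zero _)), mul_left_comm, ← Complex.exp_add]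
    simp
  obtain ⟨n, hn⟩ := Complex.exp_eq_exp_iff_exists_int.1 h
  have hpi : (Real.pi : ℂ) ≠ 0 := Complex.ofReal_ne_zero.2 Real.pi_ne_zero
  refine (congrArg (catImmersion α ρ γ) ?_).trans
    ((periodic_catImmersion hα hρ hγ).int_mul n _)
  rw [hn]
  field_simp

theorem annulusMap_exp (hα : α ∈ Ioo (-1 : ℝ) 1) (hρ : IsRho α ρ) (hγ : IsGamma α ρ γ)
    (w : ℂ) : annulusMap α ρ γ (Complex.exp w) =
      catImmersion α ρ γ ((halfPeriod α / Real.pi : ℂ) * w) := by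
  rw [annulusMap_eq hα hρ hγ w (Complex.exp_ne_zero w), ← Complex.exp_add]
  simp

theorem exists_local_reparam (hα : α ∈ Ioo (-1 : ℝ) 1) (hρ : IsRho α ρ) (hγ : IsGamma α ρ γ)
    {ζ : ℂ} (hζ : ζ ≠ 0) : ∃ h : ℂ → ℂ,
      (annulusMap α ρ γ =ᶠ[𝓝 ζ] fun w => catImmersion α ρ γ (h w)) ∧ ContDiffAt ℝ ∞ h ζ ∧
      ∀ᶠ w in 𝓝 ζ, HasDerivAt h ((halfPeriod α / Real.pi : ℂ) * w⁻¹) w := by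
  -- Dividing by `ζ` moves the base point to `1`, so this branch of the logarithm is holomorphic
  -- near `ζ` even when `ζ` lies on the negative axis.
  have hslit : ∀ᶠ w in 𝓝 ζ, w * Complex.exp (-Complex.log ζ) ∈ Complex.slitPlane := by
    have hc : ContinuousAt (fun w : ℂ => w * Complex.exp (-Complex.log ζ)) ζ := by fun_prop
    refine hc.eventually (Complex.isOpen_slitPlane.mem_nhds ?_)
    simp only [Complex.exp_neg, Complex.exp_log hζ]
    rw [mul_inv_cancel₀ hζ]
    exact Complex.one_mem_slitPlane
  refine ⟨fun w => (halfPeriod α / Real.pi : ℂ) *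
    (Complex.log ζ + Complex.log (w * Complex.exp (-Complex.log ζ))), ?_, ?_, ?_⟩
  · filter_upwards [isOpen_ne.mem_nhds hζ] with w hw
    exact annulusMap_eq hα hρ hγ _ hw
  · have h1 : ContDiffAt ℝ ∞ (fun w : ℂ => Complex.log (w * Complex.exp (-Complex.log ζ))) ζ :=
      ((Complex.contDiffAt_log hslit.self_of_nhds).restrict_scalars ℝ).comp ζ
        (contDiffAt_id.mul contDiffAt_const)
    exact contDiffAt_const.mul (contDiffAt_const.add h1)
  · filter_upwards [hslit] with w hw
    refine ((((hasDerivAt_id w).mul_const _).clog hw).const_add _ |>.const_mul _).congr_deriv ?_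
    have := Complex.exp_ne_zero (-Complex.log ζ)
    have hw0 : w ≠ 0 := by
      rintro rfl
      simp at hw
    simp only [id]
    field_simp

theorem normSq_annulus_pos (hα : α ∈ Ioo (-1 : ℝ) 1) {ζ : ℂ} (hζ : ζ ≠ 0) :
    0 < Complex.normSq ((halfPeriod α / Real.pi : ℂ) * ζ⁻¹) := by
  have h1 : (halfPeriod α : ℂ) ≠ 0 := Complex.ofReal_ne_zero.2 (halfPeriod_pos hα).ne'
  have h2 : (Real.pi : ℂ) ≠ 0 := Complex.ofReal_ne_zero.2 Real.pi_ne_zero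
  exact Complex.normSq_pos.2 (mul_ne_zero (div_ne_zero h1 h2) (inv_ne_zero hζ))

theorem firstForm_annulusMap (hα : α ∈ Ioo (-1 : ℝ) 1) (hα0 : α ≠ 0) (hρ : IsRho α ρ)
    (hγ : IsGamma α ρ γ) {ζ : ℂ} (hζ : ζ ≠ 0) :
    0 < firstForm (annulusMap α ρ γ) ζ 0 0 ∧
    firstForm (annulusMap α ρ γ) ζ 0 0 = firstForm (annulusMap α ρ γ) ζ 1 1 ∧
    firstForm (annulusMap α ρ γ) ζ 0 1 = 0 := by
  obtain ⟨h, hφ, -, hd⟩ := exists_local_reparam hα hρ hγ hζ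
  obtain ⟨f1, f2, f3⟩ := firstForm_catImmersion hα hρ hγ (h ζ)
  obtain ⟨g1, g2, g3⟩ := firstForm_reparam (k := fun w => (halfPeriod α / Real.pi : ℂ) * w⁻¹)
    (contDiff_catImmersion hα hρ hγ) hφ hd.self_of_nhds (f1.trans f2.symm) f3
  refine ⟨?_, g1.trans g2.symm, g3⟩
  rw [g1, f1]
  exact mul_pos (normSq_annulus_pos hα hζ) (catFactor_pos hα0 _)

theorem tension_annulusMap (hα : α ∈ Ioo (-1 : ℝ) 1) (hρ : IsRho α ρ)
    (hγ : IsGamma α ρ γ) {ζ : ℂ} (hζ : ζ ≠ 0) : tension (annulusMap α ρ γ) ζ = 0 := by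
  obtain ⟨h, hφ, -, hd⟩ := exists_local_reparam hα hρ hγ hζ
  rw [tension_reparam (contDiff_catImmersion hα hρ hγ) hφ hd
    ((hasDerivAt_inv hζ).const_mul _), tension_catImmersion hα hρ hγ, smul_zero]

theorem isConformalOn_annulusMap (hα : α ∈ Ioo (-1 : ℝ) 1) (hα0 : α ≠ 0) (hρ : IsRho α ρ)
    (hγ : IsGamma α ρ γ) : IsConformalOn (annulusMap α ρ γ) {0}ᶜ := fun _ hζ =>
  (firstForm_annulusMap hα hα0 hρ hγ hζ).2

theorem isMinimalOn_annulusMap (hα : α ∈ Ioo (-1 : ℝ) 1) (hα0 : α ≠ 0) (hρ : IsRho α ρ)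
    (hγ : IsGamma α ρ γ) : IsMinimalOn (annulusMap α ρ γ) {0}ᶜ := fun _ hζ =>
  have h := firstForm_annulusMap hα hα0 hρ hγ hζ
  meanCurvature_eq_zero h.2.1 h.2.2 (tension_annulusMap hα hρ hγ hζ)

theorem contDiffOn_annulusMap (hα : α ∈ Ioo (-1 : ℝ) 1) (hρ : IsRho α ρ)
    (hγ : IsGamma α ρ γ) : ContDiffOn ℝ ∞ (annulusMap α ρ γ) {0}ᶜ := fun ζ hζ => by
  obtain ⟨h, hφ, hs, -⟩ := exists_local_reparam hα hρ hγ hζ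
  exact (((contDiff_catImmersion hα hρ hγ).contDiffAt.comp ζ hs).congr_of_eventuallyEq
    hφ).contDiffWithinAt

theorem injOn_annulusMap (hα : α ∈ Ioo (-1 : ℝ) 1) (hα0 : α ≠ 0) (hρ : IsRho α ρ)
    (hγ : IsGamma α ρ γ) : InjOn (annulusMap α ρ γ) {0}ᶜ := fun ζ hζ ξ hξ h => by
  obtain ⟨k, hk⟩ := (catImmersion_eq_iff hα hα0 hρ hγ _ _).1 h
  have h1 : (halfPeriod α : ℂ) ≠ 0 := Complex.ofReal_ne_zero.2 (halfPeriod_pos hα).ne'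
  have h2 : (Real.pi : ℂ) ≠ 0 := Complex.ofReal_ne_zero.2 Real.pi_ne_zero
  rw [← Complex.exp_log hζ, ← Complex.exp_log hξ, Complex.exp_eq_exp_iff_exists_int]
  refine ⟨k, ?_⟩
  field_simp at hk
  linear_combination hk

theorem image_annulusMap (hα : α ∈ Ioo (-1 : ℝ) 1) (hρ : IsRho α ρ)
    (hγ : IsGamma α ρ γ) : annulusMap α ρ γ '' {0}ᶜ = catenoid α ρ γ := by
  apply Subset.antisymm
  · rintro _ ⟨ζ, -, rfl⟩
    exact ⟨_, rfl⟩
  · rintro _ ⟨z, rfl⟩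
    refine ⟨Complex.exp ((Real.pi / halfPeriod α : ℂ) * z), Complex.exp_ne_zero _, ?_⟩
    rw [annulusMap_exp hα hρ hγ]
    have h1 : (halfPeriod α : ℂ) ≠ 0 := Complex.ofReal_ne_zero.2 (halfPeriod_pos hα).ne'
    have h2 : (Real.pi : ℂ) ≠ 0 := Complex.ofReal_ne_zero.2 Real.pi_ne_zero
    congr 1
    field_simp

theorem annulusMap_two (ζ : ℂ) : annulusMap α ρ γ ζ 2 =
    α * (halfPeriod α / Real.pi * Real.log ‖ζ‖)
      + catF α ρ (halfPeriod α / Real.pi * Complex.arg ζ) := by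
  have h : (halfPeriod α / Real.pi : ℂ) = ((halfPeriod α / Real.pi : ℝ) : ℂ) := by push_cast; rfl
  change α * ((halfPeriod α / Real.pi : ℂ) * Complex.log ζ).re
    + catF α ρ ((halfPeriod α / Real.pi : ℂ) * Complex.log ζ).im = _
  rw [h, Complex.re_ofReal_mul, Complex.im_ofReal_mul, Complex.log_re, Complex.log_im]

theorem isProperMap_annulusMap (hα : α ∈ Ioo (-1 : ℝ) 1) (hα0 : α ≠ 0) (hρ : IsRho α ρ)
    (hγ : IsGamma α ρ γ) : IsProperMap (({0}ᶜ : Set ℂ).domRestrict (annulusMap α ρ γ)) := by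
  have hcont : Continuous (({0}ᶜ : Set ℂ).domRestrict (annulusMap α ρ γ)) :=
    (contDiffOn_annulusMap hα hρ hγ).continuousOn.domRestrict
  refine isProperMap_iff_isCompact_preimage.2 ⟨hcont, fun K hK => ?_⟩
  have hVpos := div_pos (halfPeriod_pos hα) Real.pi_pos
  obtain ⟨B, hB⟩ := (hK.image (continuous_apply (2 : Fin 3))).isBounded.exists_norm_le
  obtain ⟨M, hM⟩ := ((isCompact_Icc (a := -Real.pi) (b := Real.pi)).image
    ((hρ.contDiff_catF hα).continuous.comp
      (continuous_const_mul (halfPeriod α / Real.pi)))).isBounded.exists_norm_le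
  -- `B` bounds `x₃` on `K` and `M` bounds `F` over one period, so `C` bounds `|log |ζ||` on the
  -- preimage, which therefore lies in a closed round annulus away from `0`.
  set C := (B + M) / (|α| * (halfPeriod α / Real.pi)) with hC
  have hA : IsCompact (Metric.closedBall (0 : ℂ) (Real.exp C) \ Metric.ball 0 (Real.exp (-C))) :=
    (isCompact_closedBall _ _).diff Metric.isOpen_ball
  have hA' : IsCompact ((Subtype.val : ({0}ᶜ : Set ℂ) → ℂ) ⁻¹'
      (Metric.closedBall (0 : ℂ) (Real.exp C) \ Metric.ball 0 (Real.exp (-C)))) := by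
    refine (IsInducing.subtypeVal.isCompact_preimage_iff ?_).2 hA
    rintro ζ ⟨-, hζ⟩
    rw [Subtype.range_coe]
    rintro rfl
    exact hζ (Metric.mem_ball_self (Real.exp_pos _))
  refine hA'.of_isClosed_subset (hK.isClosed.preimage hcont) ?_
  rintro ⟨ζ, hζ⟩ hζK
  have hB' : |annulusMap α ρ γ ζ 2| ≤ B := hB _ ⟨_, hζK, rfl⟩
  have hM' : |catF α ρ (halfPeriod α / Real.pi * Complex.arg ζ)| ≤ M :=
    hM _ ⟨Complex.arg ζ, ⟨(Complex.neg_pi_lt_arg ζ).le, Complex.arg_le_pi ζ⟩, rfl⟩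
  have hlog : |Real.log ‖ζ‖| ≤ C := by
    rw [hC, le_div_iff₀ (mul_pos (abs_pos.2 hα0) hVpos)]
    calc |Real.log ‖ζ‖| * (|α| * (halfPeriod α / Real.pi))
        = |α * (halfPeriod α / Real.pi * Real.log ‖ζ‖)| := by
          rw [abs_mul, abs_mul, abs_of_pos hVpos]; ring
      _ = |annulusMap α ρ γ ζ 2 - catF α ρ (halfPeriod α / Real.pi * Complex.arg ζ)| := by
          rw [annulusMap_two]; ring_nf
      _ ≤ B + M := (abs_sub _ _).trans (add_le_add hB' hM')
  have hn : 0 < ‖ζ‖ := norm_pos_iff.2 hζ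
  have := abs_le.1 hlog
  refine ⟨?_, ?_⟩
  · rw [mem_closedBall_zero_iff]
    exact (Real.log_le_iff_le_exp hn).1 this.2
  · rw [mem_ball_zero_iff, not_lt]
    exact (Real.le_log_iff_exp_le hn).1 this.1

theorem isSmoothEmbeddingOnto_annulusMap (hα : α ∈ Ioo (-1 : ℝ) 1) (hα0 : α ≠ 0)
    (hρ : IsRho α ρ) (hγ : IsGamma α ρ γ) :
    IsSmoothEmbeddingOnto (annulusMap α ρ γ) (catenoid α ρ γ) := by
  refine ⟨⟨contDiffOn_annulusMap hα hρ hγ, fun ζ hζ => ?_⟩, ?_, image_annulusMap hα hρ hγ⟩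
  · obtain ⟨h0, h1, h2⟩ := firstForm_annulusMap hα hα0 hρ hγ hζ
    exact injective_fderiv_of_conformal h0 h1 h2
  · have hp := isProperMap_annulusMap hα hα0 hρ hγ
    exact (IsClosedEmbedding.of_continuous_injective_isClosedMap hp.continuous
      (injOn_annulusMap hα hα0 hρ hγ).injective hp.isClosedMap).isEmbedding

end

/-! ### The slice at height zero is not invariant under the exchange of the coordinates -/

section
variable {α : ℝ} {ρ γ : ℝ → ℝ}

/-- A first integral: `e^{-2γ} (α cos 2ρ + ρ')` is constant. At `ρ = π/2` it gives the exact value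
`e^{2γ} = (1 - α)/(1 + α)`. -/
theorem IsGamma.exp_two_mul (hα : α ∈ Ioo (-1 : ℝ) 1) (hρ : IsRho α ρ) (hγ : IsGamma α ρ γ)
    (v : ℝ) : Real.exp (2 * γ v) * (1 + α) = α * Real.cos (2 * ρ v) + angleSpeed α (ρ v) := by
  have hd : ∀ v, HasDerivAt (fun v => Real.exp (-(2 * γ v)) *
      (α * Real.cos (2 * ρ v) + angleSpeed α (ρ v))) 0 v := fun v => by
    refine ((((hγ.2 v).const_mul 2).fun_neg.exp).mul
      ((((hρ.hasDerivAt v).const_mul 2).cos.const_mul α).add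
        (hρ.hasDerivAt_angleSpeed hα v))).congr_deriv ?_
    simp only [Pi.add_apply]
    ring
  have h : Real.exp (-(2 * γ v)) * (α * Real.cos (2 * ρ v) + angleSpeed α (ρ v)) = 1 + α :=
    congrFun (eq_of_hasDerivAt_eq hd (fun v => hasDerivAt_const v (1 + α))
    (by simp [hγ.1, hρ.1, angleSpeed, add_comm])) v
  rw [← h, ← mul_assoc, ← Real.exp_add]
  simp

/-- The quarter of the period of the catenoid immersion. -/
def quarterPeriod (α : ℝ) : ℝ := angleTime α (Real.pi / 2)

theorem IsRho.apply_quarterPeriod (hα : α ∈ Ioo (-1 : ℝ) 1) (hρ : IsRho α ρ) :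
    ρ (quarterPeriod α) = Real.pi / 2 := hρ.apply_angleTime hα _

theorem quarterPeriod_pos (hα : α ∈ Ioo (-1 : ℝ) 1) : 0 < quarterPeriod α := by
  rw [← angleTime_zero α]
  exact strictMono_angleTime hα Real.pi_div_two_pos

theorem angleSpeed_pi_div_two (α : ℝ) : angleSpeed α (Real.pi / 2) = 1 := by
  simp [angleSpeed, mul_div_cancel₀]

theorem catSlope_pi_div_two (α : ℝ) : catSlope α (Real.pi / 2) = 0 := by
  simp [catSlope, mul_div_cancel₀]

theorem sin_two_mul_rho_pos (hα : α ∈ Ioo (-1 : ℝ) 1) (hρ : IsRho α ρ) {v : ℝ}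
    (hv : v ∈ Ioo 0 (quarterPeriod α)) : 0 < Real.sin (2 * ρ v) := by
  have h1 := hρ.strictMono hα hv.1
  have h2 := hρ.strictMono hα hv.2
  rw [hρ.1] at h1
  rw [hρ.apply_quarterPeriod hα] at h2
  exact Real.sin_pos_of_pos_of_lt_pi (by linarith) (by linarith)

theorem catF_quarterPeriod_pos (hα : α ∈ Ioo (-1 : ℝ) 1) (hα0 : α ≠ 0) (hρ : IsRho α ρ) :
    0 < catF α ρ (quarterPeriod α) := by
  have hd := hρ.hasDerivAt_catF hα
  have hmono : StrictMonoOn (catF α ρ) (Icc 0 (quarterPeriod α)) := by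
    refine strictMonoOn_of_deriv_pos (convex_Icc _ _)
      (hρ.contDiff_catF hα).continuous.continuousOn fun v hv => ?_
    rw [interior_Icc] at hv
    rw [(hd v).deriv, catSlope]
    have := sin_two_mul_rho_pos hα hρ hv
    have := one_add_angleSpeed_pos α (ρ v)
    positivity
  have hq := quarterPeriod_pos hα
  have := hmono (left_mem_Icc.2 hq.le) (right_mem_Icc.2 hq.le) hq
  rwa [catF_zero] at this

/-- On the first quarter period `F' + αγ' = α² sin(2ρ) (1/(1 + ρ') - 1)` is negative. -/
theorem catF_quarterPeriod_lt (hα : α ∈ Ioo (-1 : ℝ) 1) (hα0 : α ≠ 0) (hρ : IsRho α ρ)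
    (hγ : IsGamma α ρ γ) : catF α ρ (quarterPeriod α) < -(α * γ (quarterPeriod α)) := by
  have hd : ∀ v, HasDerivAt (fun v => catF α ρ v + α * γ v) _ v := fun v =>
    (hρ.hasDerivAt_catF hα v).add ((hγ.2 v).const_mul α)
  have hanti : StrictAntiOn (fun v => catF α ρ v + α * γ v) (Icc 0 (quarterPeriod α)) := by
    refine strictAntiOn_of_deriv_neg (convex_Icc _ _)
      (continuous_iff_continuousAt.2 fun v => (hd v).continuousAt).continuousOn fun v hv => ?_
    rw [interior_Icc] at hv
    rw [(hd v).deriv, catSlope]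
    have h1 := sin_two_mul_rho_pos hα hρ hv
    have h2 := angleSpeed_pos hα (ρ v)
    have h3 : Real.sin (2 * ρ v) / (1 + angleSpeed α (ρ v)) < Real.sin (2 * ρ v) :=
      div_lt_self h1 (by linarith)
    have h4 : 0 < α ^ 2 := by positivity
    nlinarith
  have hq := quarterPeriod_pos hα
  have := hanti (left_mem_Icc.2 hq.le) (right_mem_Icc.2 hq.le) hq
  simp only [catF_zero, hγ.1] at this
  linarith

/-- Multiplied by `E`, the difference of the two sides is a quadratic in `E` with roots `1` and `(1
- α)/(1 + α) = e^{2γ}`. The bounds `0 < F < -αγ` at the quarter period place `E = e^{γ - F/α}`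
strictly between them. -/
theorem width_lt (hα : α ∈ Ioo (-1 : ℝ) 1) (hα0 : α ≠ 0) (hρ : IsRho α ρ)
    (hγ : IsGamma α ρ γ) {E : ℝ}
    (hE : E = Real.exp (γ (quarterPeriod α) - catF α ρ (quarterPeriod α) / α)) :
    (1 + α) * E + (1 - α) * E⁻¹ < 2 := by
  have h1 := catF_quarterPeriod_pos hα hα0 hρ
  have h2 := catF_quarterPeriod_lt hα hα0 hρ hγ
  have h3 := hγ.exp_two_mul hα hρ (quarterPeriod α)
  rw [hρ.apply_quarterPeriod hα, angleSpeed_pi_div_two, mul_div_cancel₀ _ (two_ne_zero' ℝ),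
    Real.cos_pi] at h3
  generalize γ (quarterPeriod α) = a at *
  generalize catF α ρ (quarterPeriod α) = f at *
  have hf : f = α * (f / α) := by field_simp
  generalize f / α = q at *
  have hEpos : 0 < E := hE ▸ Real.exp_pos _
  have hα1 : 0 < 1 + α := by linarith [hα.1]
  have key : (E - 1) * (E - Real.exp (2 * a)) < 0 := by
    rw [hE]
    -- The sign of `α` decides which of the two roots is the larger.
    rcases hα0.lt_or_gt with h | h
    · have hq : q < 0 := by nlinarith
      have hq' : -a < q := by nlinarith
      have e1 : 1 < Real.exp (a - q) := Real.one_lt_exp_iff.2 (by linarith)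
      have e2 : Real.exp (a - q) < Real.exp (2 * a) := Real.exp_lt_exp.2 (by linarith)
      exact mul_neg_of_pos_of_neg (by linarith) (by linarith)
    · have hq : 0 < q := by nlinarith
      have hq' : q < -a := by nlinarith
      have e1 : Real.exp (a - q) < 1 := Real.exp_lt_one_iff.2 (by linarith)
      have e2 : Real.exp (2 * a) < Real.exp (a - q) := Real.exp_lt_exp.2 (by linarith)
      exact mul_neg_of_neg_of_pos (by linarith) (by linarith)
  have h4 : (1 + α) * E + (1 - α) * E⁻¹ - 2 = (1 + α) * ((E - 1) * (E - Real.exp (2 * a))) / E := by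
    field_simp
    linear_combination (E - 1) * h3
  have h5 : (1 + α) * ((E - 1) * (E - Real.exp (2 * a))) / E < 0 :=
    div_neg_of_neg_of_pos (mul_neg_of_pos_of_neg hα1 key) hEpos
  linarith

theorem sliceCurve_quarterPeriod (hα : α ∈ Ioo (-1 : ℝ) 1) (hα0 : α ≠ 0) (hρ : IsRho α ρ)
    (hγ : IsGamma α ρ γ) :
    -(α ^ 2 / (1 - α ^ 2)) < α * sliceCurve α ρ γ 0 (quarterPeriod α) 0 := by
  have hw := width_lt hα hα0 hρ hγ rfl
  set E := Real.exp (γ (quarterPeriod α) - catF α ρ (quarterPeriod α) / α) with hE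
  have hα1 : 0 < 1 + α := by linarith [hα.1]
  have hα2 : 0 < 1 - α := by linarith [hα.2]
  have hα3 : 0 < 1 - α ^ 2 := by nlinarith
  have hα4 : 0 < α ^ 2 := by positivity
  have e0 : -α * ((0 - catF α ρ (quarterPeriod α)) / α) - catF α ρ (quarterPeriod α) = 0 := by
    field_simp
    ring
  have e1 : Real.exp ((0 - catF α ρ (quarterPeriod α)) / α + γ (quarterPeriod α)) = E := by
    rw [hE]; congr 1; ring
  have e2 : Real.exp (-((0 - catF α ρ (quarterPeriod α)) / α) - γ (quarterPeriod α)) = E⁻¹ := by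
    rw [hE, ← Real.exp_neg]; congr 1; ring
  have hval : sliceCurve α ρ γ 0 (quarterPeriod α) 0 =
      -(α / (2 * (1 - α ^ 2)) * ((1 + α) * E + (1 - α) * E⁻¹)) := by
    change catX1 α ρ γ (sliceParam α ρ 0 (quarterPeriod α)).re
      (sliceParam α ρ 0 (quarterPeriod α)).im = _
    rw [sliceParam_re, sliceParam_im, catX1, e0, e1, e2, hρ.deriv_catF hα,
      hρ.apply_quarterPeriod hα, catSlope_pi_div_two, Real.sin_pi_div_two, Real.exp_zero,
      show 1 - α ^ 2 = (1 - α) * (1 + α) by ring]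
    field_simp
    ring
  rw [hval]
  have h : α ^ 2 / (1 - α ^ 2) - α * (α / (2 * (1 - α ^ 2)) * ((1 + α) * E + (1 - α) * E⁻¹)) =
      α ^ 2 / (2 * (1 - α ^ 2)) * (2 - ((1 + α) * E + (1 - α) * E⁻¹)) := by
    field_simp
  have h' : 0 < α ^ 2 / (2 * (1 - α ^ 2)) * (2 - ((1 + α) * E + (1 - α) * E⁻¹)) :=
    mul_pos (by positivity) (by linarith)
  linarith

/-- At the quarter period `ρ = π/2`, so the tangent of the slice is parallel to the `x₂`-axis; by
convexity `α x₁` is minimal there. -/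
theorem lt_of_mem_catenoid (hα : α ∈ Ioo (-1 : ℝ) 1) (hα0 : α ≠ 0) (hρ : IsRho α ρ)
    (hγ : IsGamma α ρ γ) {p : Sol3} (hp : p ∈ catenoid α ρ γ) (h2 : p 2 = 0) :
    -(α ^ 2 / (1 - α ^ 2)) < α * p 0 := by
  obtain ⟨z, rfl⟩ := hp
  have hz : catImmersion α ρ γ z 0 = sliceCurve α ρ γ 0 z.im 0 := by
    rw [sliceCurve, ← eq_sliceParam hα0 h2, cons_val_zero]
  rw [hz]
  refine (sliceCurve_quarterPeriod hα hα0 hρ hγ).trans_le ?_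
  rcases sliceCurve_tangent_side hα hα0 hρ hγ 0 z.im (quarterPeriod α) with h | h
  · rw [(sliceCurve_eq_iff hα hα0 hρ hγ 0 _ _).2 h]
  · rw [hρ.apply_quarterPeriod hα, Real.cos_pi_div_two, Real.sin_pi_div_two, Real.exp_zero] at h
    have hpos : 0 < catDensity α (ρ (quarterPeriod α)) *
        Real.cosh ((0 - catF α ρ (quarterPeriod α)) / α + γ (quarterPeriod α)) / α ^ 2 :=
      div_pos (mul_pos (catDensity_pos hα0 _) (Real.cosh_pos _)) (by positivity)
    have e : sliceSpeed α ρ γ 0 (quarterPeriod α) = -(catDensity α (ρ (quarterPeriod α)) *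
        Real.cosh ((0 - catF α ρ (quarterPeriod α)) / α + γ (quarterPeriod α)) / α ^ 2) * α := by
      rw [sliceSpeed]; field_simp
    rw [e] at h
    nlinarith

theorem mem_catenoid_of_sign (hα : α ∈ Ioo (-1 : ℝ) 1) (hρ : IsRho α ρ)
    (hγ : IsGamma α ρ γ) {ε : ℝ} (hε : ε = 1 ∨ ε = -1) :
    ![0, -(ε * (α / (1 - α ^ 2))), 0] ∈ catenoid α ρ γ := by
  have hα1 : 1 + α ≠ 0 := by linarith [hα.1]
  have hα2 : 1 - α ≠ 0 := by linarith [hα.2]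
  have h0 : catImmersion α ρ γ 0 = ![0, α / (1 - α ^ 2), 0] := by
    ext i
    fin_cases i
    · simp [catImmersion, catX1, hρ.1, hρ.deriv_catF hα, catSlope]
    · simp [catImmersion, catX2, hρ.1, hγ.1, catF_zero, hρ.deriv_catF hα, catSlope]
      rw [show 1 - α ^ 2 = (1 - α) * (1 + α) by ring]
      field_simp
      ring
    · simp [catImmersion, catX3, catF_zero]
  have hmem : ![0, α / (1 - α ^ 2), 0] ∈ catenoid α ρ γ := ⟨0, h0⟩
  rcases hε with rfl | rfl
  · rw [← image_rotationX3_catenoid hα hρ hγ]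
    refine ⟨_, hmem, ?_⟩
    ext i
    fin_cases i <;> simp [rotationX3]
  · simpa using hmem

end

/-! ### The isotropy group of the origin -/

/-- These signed forms contain `σ` and `τ` and are closed under products and inverses; `x₃` changes
sign exactly when `x₁` and `x₂` are exchanged. -/
theorem exists_signs_of_mem_originIsotropy {s : Equiv.Perm Sol3} (hs : s ∈ originIsotropy) :
    ∃ ε δ : ℝ, (ε = 1 ∨ ε = -1) ∧ (δ = 1 ∨ δ = -1) ∧
      ((∀ x, s x = ![ε * x 0, δ * x 1, x 2]) ∨ ∀ x, s x = ![ε * x 1, δ * x 0, -x 2]) := by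
  have hmul : ∀ {a b : ℝ}, (a = 1 ∨ a = -1) → (b = 1 ∨ b = -1) → (a * b = 1 ∨ a * b = -1) := by
    rintro a b (rfl | rfl) (rfl | rfl) <;> simp
  induction hs using Subgroup.closure_induction with
  | mem s hs =>
    rcases hs with rfl | rfl
    · exact ⟨1, -1, by simp, by simp, Or.inr fun x => by simp [isoSigma]⟩
    · exact ⟨-1, 1, by simp, by simp, Or.inl fun x => by simp [isoTau]⟩
  | one =>
    refine ⟨1, 1, by simp, by simp, Or.inl fun x => ?_⟩
    ext i
    fin_cases i <;> simp
  | mul s t _ _ hs ht =>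
    obtain ⟨a, b, ha, hb, h1⟩ := hs
    obtain ⟨c, d, hc, hd, h2⟩ := ht
    rcases h1 with h1 | h1 <;> rcases h2 with h2 | h2
    · exact ⟨a * c, b * d, hmul ha hc, hmul hb hd,
        Or.inl fun x => by simp [h1, h2, mul_assoc]⟩
    · exact ⟨a * c, b * d, hmul ha hc, hmul hb hd,
        Or.inr fun x => by simp [h1, h2, mul_assoc]⟩
    · exact ⟨a * d, b * c, hmul ha hd, hmul hb hc,
        Or.inr fun x => by simp [h1, h2, mul_assoc]⟩
    · exact ⟨a * d, b * c, hmul ha hd, hmul hb hc,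
        Or.inl fun x => by simp [h1, h2, mul_assoc]⟩
  | inv s _ hs =>
    obtain ⟨a, b, ha, hb, h⟩ := hs
    have haa : ∀ r, a * (a * r) = r := fun r => by rcases ha with rfl | rfl <;> simp
    have hbb : ∀ r, b * (b * r) = r := fun r => by rcases hb with rfl | rfl <;> simp
    rcases h with h | h
    · refine ⟨a, b, ha, hb, Or.inl fun x => ?_⟩
      rw [Equiv.Perm.inv_eq_iff_eq, h]
      ext i
      fin_cases i <;> simp [haa, hbb]
    · refine ⟨b, a, hb, ha, Or.inr fun x => ?_⟩
      rw [Equiv.Perm.inv_eq_iff_eq, h]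
      ext i
      fin_cases i <;> simp [haa, hbb]

theorem isotropy_catenoid {α : ℝ} {ρ γ : ℝ → ℝ} (hα : α ∈ Ioo (-1 : ℝ) 1) (hα0 : α ≠ 0)
    (hρ : IsRho α ρ) (hγ : IsGamma α ρ γ) {s : Equiv.Perm Sol3} (hs : s ∈ originIsotropy)
    (h : s '' catenoid α ρ γ = catenoid α ρ γ) :
    (s : Sol3 → Sol3) = id ∨ (s : Sol3 → Sol3) = rotationX3 ∨
      (s : Sol3 → Sol3) = reflectionX1 ∨ (s : Sol3 → Sol3) = reflectionX2 := by
  obtain ⟨ε, δ, hε, hδ, h1 | h1⟩ := exists_signs_of_mem_originIsotropy hs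
  · have hid : ∀ x : Sol3, ![x 0, x 1, x 2] = x := fun x => by
      ext i; fin_cases i <;> rfl
    rcases hε with rfl | rfl <;> rcases hδ with rfl | rfl
    · exact Or.inl (funext fun x => by simp [h1, hid])
    · exact Or.inr (Or.inr (Or.inr (funext fun x => by simp [h1, reflectionX2])))
    · exact Or.inr (Or.inr (Or.inl (funext fun x => by simp [h1, reflectionX1])))
    · exact Or.inr (Or.inl (funext fun x => by simp [h1, rotationX3]))
  · exfalso
    -- The sign is chosen so that the image has first coordinate `-α/(1 - α²)`, where the strict
    -- bound fails by equality.
    have hmem : s ![0, -(ε * (α / (1 - α ^ 2))), 0] ∈ catenoid α ρ γ :=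
      h ▸ mem_image_of_mem s (mem_catenoid_of_sign hα hρ hγ hε)
    have hlt := lt_of_mem_catenoid hα hα0 hρ hγ hmem (by simp [h1])
    have hεε : ε * ε = 1 := by rcases hε with rfl | rfl <;> norm_num
    have e : α * s ![0, -(ε * (α / (1 - α ^ 2))), 0] 0 = -(α ^ 2 / (1 - α ^ 2)) := by
      simp only [h1, cons_val_zero, cons_val_one]
      linear_combination -(α ^ 2 / (1 - α ^ 2)) * hεε
    exact hlt.ne' e

end

theorem mainTheorem1 (α : ℝ) (hα : α ∈ Set.Ioo (-1 : ℝ) 1) (hα0 : α ≠ 0) :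
    ∃ ρ γ : ℝ → ℝ,
      -- `ρ` and `γ` are the unique solutions of the two Cauchy problems
      (IsRho α ρ ∧ ∀ ρ' : ℝ → ℝ, IsRho α ρ' → ρ' = ρ) ∧
      (IsGamma α ρ γ ∧ ∀ γ' : ℝ → ℝ, IsGamma α ρ γ' → γ' = γ) ∧
      -- the explicit map `x` is a conformal minimal immersion of `ℂ` with Gauss map `g`
      IsSmoothImmersionOn (catImmersion α ρ γ) Set.univ ∧
      IsConformalOn (catImmersion α ρ γ) Set.univ ∧
      IsMinimalOn (catImmersion α ρ γ) Set.univ ∧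
      (∀ z : ℂ, gaussMap (catImmersion α ρ γ) z = (catGauss ρ γ z : OnePoint ℂ)) ∧
      -- it is `2iV`-periodic, where `ρ(v + V) = ρ(v) + π`, and injective modulo `2iVℤ`
      (∃ V : ℝ, 0 < V ∧ (∀ v, ρ (v + V) = ρ v + Real.pi) ∧
        (∀ z : ℂ, catImmersion α ρ γ (z + 2 * Complex.I * V) = catImmersion α ρ γ z) ∧
        (∀ z w : ℂ, catImmersion α ρ γ z = catImmersion α ρ γ w ↔
          ∃ k : ℤ, z = w + k * (2 * Complex.I * V))) ∧
      -- the surface `𝒞_α` is a properly embedded minimal annulus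
      IsProperlyEmbeddedMinimalAnnulus (catenoid α ρ γ) ∧
      -- its horizontal slices are non-empty closed embedded convex curves
      (∀ l : ℝ, (slice (catenoid α ρ γ) l).Nonempty ∧
        IsClosedEmbeddedConvexCurve (slice (catenoid α ρ γ) l)) ∧
      -- it is conformally equivalent to `ℂ ∖ {0}`
      IsConformalToPuncturedPlane (catenoid α ρ γ) ∧
      -- it has three symmetries fixing the origin
      rotationX3 '' catenoid α ρ γ = catenoid α ρ γ ∧
      reflectionX1 '' catenoid α ρ γ = catenoid α ρ γ ∧
      reflectionX2 '' catenoid α ρ γ = catenoid α ρ γ ∧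
      -- and, besides the identity, no other one in the isotropy group of the origin
      (∀ s ∈ originIsotropy, s '' catenoid α ρ γ = catenoid α ρ γ →
        (s : Sol3 → Sol3) = id ∨ (s : Sol3 → Sol3) = rotationX3 ∨
          (s : Sol3 → Sol3) = reflectionX1 ∨ (s : Sol3 → Sol3) = reflectionX2) := by
  obtain ⟨ρ, hρ⟩ := exists_isRho hα
  obtain ⟨γ, hγ⟩ := exists_isGamma α (hρ.contDiff hα).continuous
  have hff := firstForm_catImmersion hα hρ hγ
  have hmin : IsMinimalOn (catImmersion α ρ γ) Set.univ := fun z _ =>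
    meanCurvature_eq_zero ((hff z).1.trans (hff z).2.1.symm) (hff z).2.2
      (tension_catImmersion hα hρ hγ z)
  have hemb := isSmoothEmbeddingOnto_annulusMap hα hα0 hρ hγ
  refine ⟨ρ, γ, ⟨hρ, fun _ => hρ.unique hα⟩, ⟨hγ, fun _ => hγ.unique⟩,
    ⟨(contDiff_catImmersion hα hρ hγ).contDiffOn, fun z _ => ?_⟩,
    fun z _ => ⟨(hff z).1.trans (hff z).2.1.symm, (hff z).2.2⟩, hmin,
    gaussMap_catImmersion hα hα0 hρ hγ,
    ⟨halfPeriod α, halfPeriod_pos hα, hρ.add_halfPeriod hα, catImmersion_add_period hα hρ hγ,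
      catImmersion_eq_iff hα hα0 hρ hγ⟩,
    ⟨_, hemb, isProperMap_annulusMap hα hα0 hρ hγ, isMinimalOn_annulusMap hα hα0 hρ hγ⟩,
    fun l => ⟨?_, isClosedEmbeddedConvexCurve_slice hα hα0 hρ hγ l⟩,
    ⟨_, hemb, isConformalOn_annulusMap hα hα0 hρ hγ⟩,
    image_rotationX3_catenoid hα hρ hγ, image_reflectionX1_catenoid hα hρ hγ,
    image_reflectionX2_catenoid hα hρ hγ, fun s hs => isotropy_catenoid hα hα0 hρ hγ hs⟩
  · exact injective_fderiv_of_conformal ((hff z).1 ▸ catFactor_pos hα0 z)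
      ((hff z).1.trans (hff z).2.1.symm) (hff z).2.2
  · rw [← range_sliceCurve hα0]
    exact range_nonempty _
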